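/- Let $n\ge 1$ and $\lambda>-1$. Write $\mathbb{B}^n$ for the open unit ball of $\mathbb{C}^n$, $\mathbb{T}^n$ for the torus, $\mathbb{R}^n_+=(0,\infty)^n$, $\mathbb{Z}_+=\{0,1,2,\dots\}$, $\|h\|_1=\sum_j|h_j|$, $|p|=\sum_j p_j$, $p!=\prod_j p_j!$ and $h^{p/2}=\prod_j h_j^{p_j/2}$ for $p\in\mathbb{Z}^n_+$, and $(x)_k=x(x+1)\cdots(x+k-1)$. Let $c_\lambda=\frac{\Gamma(n+\lambda+1)}{\pi^n\Gamma(\lambda+1)}$ and consider the measures $$dv_\lambda(z)=c_\lambda(1-|z|^2)^\lambda\,dv(z)\ \text{ on }\mathbb{B}^n,\qquad d\widetilde\nu_\lambda(h)=\frac{c_\lambda\,dh}{2^n(1+\|h\|_1)^{n+\lambda+1}}\ \text{ on }\mathbb{R}^n_+,\qquad d\nu_\lambda(t,h)=\frac{dt}{it}\,d\widetilde\nu_\lambda(h)\ \text{ on }\mathbb{T}^n\times\mathbb{R}^n_+,$$ where $dv$ is Lebesgue measure and $\frac{dt}{it}=\prod_j\frac{dt_j}{it_j}$ is the product of the arc length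 measures. Let $\mathcal{A}^2_\lambda(\mathbb{B}^n)\subset L^2(\mathbb{B}^n,v_\lambda)$ be the subspace of holomorphic functions, and let $$U_0:L^2(\mathbb{B}^n,v_\lambda)\to L^2(\mathbb{T}^n\times\mathbb{R}^n_+,\nu_\lambda),\quad (U_0f)(t,h)=f\left(\frac{(t_1h_1^{1/2},\dots,t_nh_n^{1/2})}{(1+\|h\|_1)^{1/2}}\right),$$ $$U_1:L^2(\mathbb{T}^n\times\mathbb{R}^n_+,\nu_\lambda)\to\ell^2\big(\mathbb{Z}^n,L^2(\mathbb{R}^n_+,\widetilde\nu_\lambda)\big),\quad (U_1f)(p,h)=\frac{1}{(2\pi)^{n/2}}\int_{\mathbb{T}^n}f(t,h)\,t^{-p}\,\frac{dt}{it}.$$ Then $U_0$ and $U_1$ are well-defined unitary operators. Moreover, the map $W_\lambda:\ell^2(\mathbb{Z}^n_+)\to\ell^2\big(\mathbb{Z}^n,L^2(\mathbb{R}^n_+,\widetilde\nu_\lambda)\big)$ given by $$W_\lambda(\psi)(p,h)=\sqrt{\frac{(2\pi)^n(\lambda+1)_{n+|p|}}{p!\,(\lambda+1)_n}}\;\frac{h^{p/2}}{(1+\|h\|_1)^{|p|/2}}\;\psi(p)\quad\text{for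 }p\in\mathbb{Z}^n_+,$$ and $W_\lambda(\psi)(p,\cdot)=0$ for $p\in\mathbb{Z}^n\setminus\mathbb{Z}^n_+$, is a well-defined linear isometry that satisfies: 1. $W_\lambda(\ell^2(\mathbb{Z}^n_+))=(U_1\circ U_0)(\mathcal{A}^2_\lambda(\mathbb{B}^n))$; 2. the adjoint of $W_\lambda$ is given by the absolutely convergent integrals $$(W_\lambda^*\varphi)(p)=\sqrt{\frac{(\lambda+1)_n(\lambda+1)_{n+|p|}}{(2\pi)^n\,p!}}\int_{\mathbb{R}^n_+}\frac{h^{p/2}\varphi(p,h)\,dh}{(1+\|h\|_1)^{\frac{|p|}{2}+n+\lambda+1}}$$ for every $p\in\mathbb{Z}^n_+$ and $\varphi\in\ell^2\big(\mathbb{Z}^n,L^2(\mathbb{R}^n_+,\widetilde\nu_\lambda)\big)$. In particular, $R_\lambda=W_\lambda^*\circ U_1\circ U_0:L^2(\mathbb{B}^n,v_\lambda)\to\ell^2(\mathbb{Z}^n_+)$ is a surjective partial isometry with initial space $\mathcal{A}^2_\lambda(\mathbb{B}^n)$. -/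

import Mathlib

open MeasureTheory
open scoped ENNReal InnerProductSpace

noncomputable section

namespace QuasiElliptic

/-- The open Euclidean unit ball of `ℂⁿ`. -/
def ball (n : ℕ) : Set (Fin n → ℂ) := {z | ∑ i, ‖z i‖ ^ 2 < 1}

/-- The open orthant `ℝⁿ₊` of vectors with positive coordinates. -/
def orthant (n : ℕ) : Set (Fin n → ℝ) := {h | ∀ i, 0 < h i}

/-- The norm `‖h‖₁`. -/
def norm1 {n : ℕ} (h : Fin n → ℝ) : ℝ := ∑ i, |h i|

/-- The constant `c_λ = Γ(n + λ + 1) / (πⁿ Γ(λ + 1))`. -/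
def cConst (n : ℕ) (lam : ℝ) : ℝ :=
  Real.Gamma (n + lam + 1) / (Real.pi ^ n * Real.Gamma (lam + 1))

/-- The Pochhammer symbol `(x)_k = x (x + 1) ⋯ (x + k - 1)`. -/
def poch (x : ℝ) (k : ℕ) : ℝ := (ascPochhammer ℝ k).eval x

/-- The measure `dv_λ(z) = c_λ (1 - |z|²)^λ dv(z)` on the unit ball. -/
def vMeasure (n : ℕ) (lam : ℝ) : Measure (Fin n → ℂ) :=
  (volume.restrict (ball n)).withDensity fun z =>
    ENNReal.ofReal (cConst n lam * (1 - ∑ i, ‖z i‖ ^ 2) ^ lam)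

/-- The Borel σ-algebra of the unit circle. -/
instance instMeasurableSpaceCircle : MeasurableSpace Circle := borel Circle

instance instBorelSpaceCircle : BorelSpace Circle := ⟨rfl⟩

/-- The arc length measure `dt/(it)` on the unit circle, of total mass `2π`. -/
def arcMeasure : Measure Circle :=
  (volume.restrict (Set.Ioc (-Real.pi) Real.pi)).map Circle.exp

/-- The product measure `∏ⱼ dtⱼ/(itⱼ)` on the torus `𝕋ⁿ`. -/
def torusMeasure (n : ℕ) : Measure (Fin n → Circle) :=
  Measure.pi fun _ => arcMeasure

/-- The measure `c_λ dh / (2ⁿ (1 + ‖h‖₁)^(n+λ+1))` on `ℝⁿ₊`. -/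
def orthantMeasure (n : ℕ) (lam : ℝ) : Measure (Fin n → ℝ) :=
  (volume.restrict (orthant n)).withDensity fun h =>
    ENNReal.ofReal (cConst n lam / (2 ^ n * (1 + norm1 h) ^ ((n : ℝ) + lam + 1)))

/-- The measure `ν_λ` on `𝕋ⁿ × ℝⁿ₊`, product of `dt/(it)` and `orthantMeasure`. -/
def nuMeasure (n : ℕ) (lam : ℝ) : Measure ((Fin n → Circle) × (Fin n → ℝ)) :=
  (torusMeasure n).prod (orthantMeasure n lam)

/-- `L²(𝔹ⁿ, v_λ)`. -/
abbrev L2Ball (n : ℕ) (lam : ℝ) := Lp ℂ 2 (vMeasure n lam)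

/-- `L²(𝕋ⁿ × ℝⁿ₊, ν_λ)`. -/
abbrev L2Coord (n : ℕ) (lam : ℝ) := Lp ℂ 2 (nuMeasure n lam)

/-- `L²(ℝⁿ₊, ν̃_λ)`. -/
abbrev L2Orthant (n : ℕ) (lam : ℝ) := Lp ℂ 2 (orthantMeasure n lam)

/-- `ℓ²(ℤⁿ, L²(ℝⁿ₊, ν̃_λ))`. -/
abbrev SeqL2Orthant (n : ℕ) (lam : ℝ) := lp (fun _ : Fin n → ℤ => L2Orthant n lam) 2

/-- `ℓ²(ℤⁿ₊)`, where `ℤ₊` is the set of non-negative integers. -/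
abbrev SeqNat (n : ℕ) := lp (fun _ : Fin n → ℕ => ℂ) 2

/-- The weighted Bergman space: the classes in `L²(𝔹ⁿ, v_λ)` of holomorphic functions. -/
def bergman (n : ℕ) (lam : ℝ) : Submodule ℂ (L2Ball n lam) where
  carrier := {f | ∃ g : (Fin n → ℂ) → ℂ, DifferentiableOn ℂ g (ball n) ∧
    f =ᵐ[vMeasure n lam] g}
  add_mem' := by
    rintro a b ⟨g, hg, hga⟩ ⟨k, hk, hkb⟩
    exact ⟨g + k, hg.add hk, (Lp.coeFn_add a b).trans (hga.add hkb)⟩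
  zero_mem' := ⟨0, differentiableOn_const 0, Lp.coeFn_zero _ _ _⟩
  smul_mem' := by
    rintro c a ⟨g, hg, hga⟩
    exact ⟨c • g, hg.const_smul c, (Lp.coeFn_smul c a).trans (hga.const_smul c)⟩

/-- The group-moment coordinates `κ(t, h) = (1 + ‖h‖₁)^(-1/2) (t₁ √h₁, …, tₙ √hₙ)`. -/
def kappa {n : ℕ} (x : (Fin n → Circle) × (Fin n → ℝ)) : Fin n → ℂ :=
  fun i => (x.1 i : ℂ) * ((√(x.2 i) / √(1 + norm1 x.2) : ℝ) : ℂ)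

/-- `U₀` is the operator `f ↦ f ∘ κ`; the condition runs over all representatives. -/
def IsU0 {n : ℕ} {lam : ℝ} (U₀ : L2Ball n lam ≃ₗᵢ[ℂ] L2Coord n lam) : Prop :=
  ∀ (f : (Fin n → ℂ) → ℂ) (hf : MemLp f 2 (vMeasure n lam)),
    ∃ hfk : MemLp (f ∘ kappa) 2 (nuMeasure n lam), U₀ (hf.toLp f) = hfk.toLp (f ∘ kappa)

/-- `U₁ = F ⊗ I`, with `F` the discrete Fourier transform in the torus variable:
`(U₁ f)(p, h) = (2π)^(-n/2) ∫ f(t, h) t^(-p) dt/(it)`. -/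
def IsU1 {n : ℕ} {lam : ℝ} (U₁ : L2Coord n lam ≃ₗᵢ[ℂ] SeqL2Orthant n lam) : Prop :=
  ∀ (f : L2Coord n lam) (p : Fin n → ℤ),
    (U₁ f p : (Fin n → ℝ) → ℂ) =ᵐ[orthantMeasure n lam] fun h =>
      (((2 * Real.pi) ^ (-(n : ℝ) / 2) : ℝ) : ℂ) *
        ∫ t, f (t, h) * ∏ i, ((t i : ℂ) ^ (-p i)) ∂(torusMeasure n)

/-- The monomial `h^(p/2)`. -/
def halfPow {n : ℕ} (h : Fin n → ℝ) (p : Fin n → ℕ) : ℝ := ∏ i, h i ^ ((p i : ℝ) / 2)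

/-- `|p| = p₁ + ⋯ + pₙ`. -/
def deg {n : ℕ} (p : Fin n → ℕ) : ℕ := ∑ i, p i

/-- `p! = p₁! ⋯ pₙ!`. -/
def multiFact {n : ℕ} (p : Fin n → ℕ) : ℝ := ∏ i, ((p i).factorial : ℝ)

/-- `W` is the map given for `p ∈ ℤⁿ₊` by the normalized functions
`√((2π)ⁿ (λ+1)_{n+|p|} / (p! (λ+1)_n)) h^(p/2) (1 + ‖h‖₁)^(-|p|/2) ψ(p)`, and by zero at the
other points of `ℤⁿ`. -/
def IsW {n : ℕ} {lam : ℝ} (W : SeqNat n → SeqL2Orthant n lam) : Prop :=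
  ∀ ψ : SeqNat n,
    (∀ p : Fin n → ℕ,
      (W ψ (fun i => (p i : ℤ)) : (Fin n → ℝ) → ℂ) =ᵐ[orthantMeasure n lam] fun h =>
        ((√((2 * Real.pi) ^ n * poch (lam + 1) (n + deg p) /
              (multiFact p * poch (lam + 1) n)) *
            (halfPow h p / (1 + norm1 h) ^ ((deg p : ℝ) / 2)) : ℝ) : ℂ) * ψ p) ∧
    (∀ q : Fin n → ℤ, (∃ i, q i < 0) → W ψ q = 0)

/-- The integrand of the adjoint formula. -/
def adjointIntegrand {n : ℕ} {lam : ℝ} (φ : SeqL2Orthant n lam) (p : Fin n → ℕ)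
    (h : Fin n → ℝ) : ℂ :=
  ((halfPow h p / (1 + norm1 h) ^ ((deg p : ℝ) / 2 + n + lam + 1) : ℝ) : ℂ) *
    φ (fun i => (p i : ℤ)) h

/-- `T` is a partial isometry with initial space `S`: `S` is the orthogonal complement of the
kernel, and `T` is isometric on `S`. -/
def IsPartialIsometryWithInitialSpace {E F : Type*} [NormedAddCommGroup E]
    [InnerProductSpace ℂ E] [NormedAddCommGroup F] [InnerProductSpace ℂ F]
    (T : E →L[ℂ] F) (S : Submodule ℂ E) : Prop :=
  S = (LinearMap.ker T.toLinearMap)ᗮ ∧ ∀ x ∈ S, ‖T x‖ = ‖x‖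

/-- The operator `R = W* ∘ U₁ ∘ U₀`. -/
def ROp {n : ℕ} {lam : ℝ} (U₀ : L2Ball n lam ≃ₗᵢ[ℂ] L2Coord n lam)
    (U₁ : L2Coord n lam ≃ₗᵢ[ℂ] SeqL2Orthant n lam)
    (W : SeqNat n →ₗᵢ[ℂ] SeqL2Orthant n lam) : L2Ball n lam →L[ℂ] SeqNat n :=
  ContinuousLinearMap.adjoint W.toContinuousLinearMap ∘L
    U₁.toLinearIsometry.toContinuousLinearMap ∘L U₀.toLinearIsometry.toContinuousLinearMap

end QuasiElliptic

end

noncomputable section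

namespace QuasiElliptic

theorem lintegral_fin_prod_eq_prod {n : ℕ} {E : Type*} [MeasurableSpace E]
    (μ : Measure E) [SigmaFinite μ] (f : Fin n → E → ℝ≥0∞) (hf : ∀ i, Measurable (f i)) :
    ∫⁻ x, ∏ i, f i (x i) ∂(Measure.pi fun _ : Fin n => μ) = ∏ i, ∫⁻ x, f i x ∂μ := by
  induction n with
  | zero => simp
  | succ n ih =>
    have hmp := (measurePreserving_piFinSuccAbove (fun _ : Fin (n + 1) => μ) 0)
    have key : ∀ x : Fin (n + 1) → E, ∏ i, f i (x i) =
        (fun y : E × (Fin n → E) => f 0 y.1 * ∏ i : Fin n, f i.succ (y.2 i))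
          (MeasurableEquiv.piFinSuccAbove (fun _ : Fin (n + 1) => E) 0 x) := by
      intro x
      rw [Fin.prod_univ_succ]
      rfl
    simp_rw [key]
    rw [hmp.lintegral_comp_emb (MeasurableEquiv.measurableEmbedding _)
        (fun y : E × (Fin n → E) => f 0 y.1 * ∏ i : Fin n, f i.succ (y.2 i)),
      lintegral_prod_mul (f := f 0) (g := fun y : Fin n → E => ∏ i : Fin n, f i.succ (y i))
        (hf 0).aemeasurable, ih _ (fun i => hf _), Fin.prod_univ_succ]
    exact (Finset.measurable_prod _ fun i _ =>
      (hf _).comp (measurable_pi_apply i)).aemeasurable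

theorem lintegral_rpow_mul_exp_neg_mul_Ioi {a r : ℝ} (ha : 0 < a) (hr : 0 < r) :
    ∫⁻ t in Set.Ioi (0 : ℝ), ENNReal.ofReal (t ^ (a - 1) * Real.exp (-(r * t))) =
      ENNReal.ofReal ((1 / r) ^ a * Real.Gamma a) := by
  have h := Real.integral_rpow_mul_exp_neg_mul_Ioi ha hr
  have hpos : 0 < (1 / r) ^ a * Real.Gamma a :=
    mul_pos (Real.rpow_pos_of_pos (by positivity) _) (Real.Gamma_pos_of_pos ha)
  rw [← h, ofReal_integral_eq_lintegral_ofReal]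
  · exact not_imp_comm.1 integral_undef (by rw [h]; exact hpos.ne')
  · refine (ae_restrict_iff' measurableSet_Ioi).2 (.of_forall fun t ht => ?_)
    exact mul_nonneg (Real.rpow_nonneg (le_of_lt ht) _) (Real.exp_pos _).le

theorem orthant_eq_pi (n : ℕ) : orthant n = Set.univ.pi fun _ => Set.Ioi 0 := by
  ext h; simp [orthant]

theorem measurableSet_orthant (n : ℕ) : MeasurableSet (orthant n) := by
  rw [orthant_eq_pi]
  exact MeasurableSet.univ_pi fun _ => measurableSet_Ioi

theorem volume_restrict_orthant (n : ℕ) :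
    (volume : Measure (Fin n → ℝ)).restrict (orthant n) =
      Measure.pi fun _ => volume.restrict (Set.Ioi 0) := by
  rw [orthant_eq_pi, volume_pi, Measure.restrict_pi_pi]

theorem norm1_of_mem {n : ℕ} {h : Fin n → ℝ} (hh : h ∈ orthant n) : norm1 h = ∑ i, h i :=
  Finset.sum_congr rfl fun i _ => abs_of_pos (hh i)

theorem norm1_nonneg {n : ℕ} (h : Fin n → ℝ) : 0 ≤ norm1 h :=
  Finset.sum_nonneg fun _ _ => abs_nonneg _

theorem one_add_norm1_pos {n : ℕ} (h : Fin n → ℝ) : 0 < 1 + norm1 h :=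
  add_pos_of_pos_of_nonneg one_pos (norm1_nonneg h)

@[fun_prop]
theorem continuous_norm1 {n : ℕ} : Continuous (norm1 : (Fin n → ℝ) → ℝ) := by
  unfold norm1; fun_prop

@[fun_prop]
theorem measurable_norm1 {n : ℕ} : Measurable (norm1 : (Fin n → ℝ) → ℝ) :=
  continuous_norm1.measurable

theorem multiFact_pos {n : ℕ} (p : Fin n → ℕ) : 0 < multiFact p :=
  Finset.prod_pos fun i _ => by positivity

/-- The Dirichlet integral over the orthant. -/
theorem lintegral_dirichlet {n : ℕ} {b : ℝ} (hb : 0 < b) (p : Fin n → ℕ) :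
    ∫⁻ h in orthant n, ENNReal.ofReal ((∏ i, h i ^ p i) /
        (1 + norm1 h) ^ ((deg p : ℝ) + n + b)) =
      ENNReal.ofReal (multiFact p * Real.Gamma b / Real.Gamma (deg p + n + b)) := by
  set M : ℝ := (deg p : ℝ) + n + b with hM
  have hMpos : 0 < M := by positivity
  have hG := Real.Gamma_pos_of_pos hMpos
  have step : ∀ s : ℝ, 0 < s → ∫⁻ h in orthant n,
      ENNReal.ofReal ((∏ i, h i ^ p i) * (s ^ (M - 1) * Real.exp (-((1 + norm1 h) * s)))) =
      ENNReal.ofReal (multiFact p) * ENNReal.ofReal (s ^ (b - 1) * Real.exp (-(1 * s))) := by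
    intro s hs
    have h1 : ∀ h ∈ orthant n,
        ENNReal.ofReal ((∏ i, h i ^ p i) * (s ^ (M - 1) * Real.exp (-((1 + norm1 h) * s)))) =
        ENNReal.ofReal (s ^ (M - 1) * Real.exp (-(1 * s))) *
          ∏ i, ENNReal.ofReal (h i ^ (((p i : ℝ) + 1) - 1) * Real.exp (-(s * h i))) := by
      intro h hh
      have hnn : ∀ i, 0 ≤ h i ^ (((p i : ℝ) + 1) - 1) * Real.exp (-(s * h i)) := fun i =>
        mul_nonneg (Real.rpow_nonneg (hh i).le _) (Real.exp_pos _).le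
      rw [← ENNReal.ofReal_prod_of_nonneg (fun i _ => hnn i),
        ← ENNReal.ofReal_mul (by positivity)]
      congr 1
      rw [Finset.prod_mul_distrib, ← Real.exp_sum, norm1_of_mem hh]
      have : Real.exp (-((1 + ∑ i, h i) * s)) =
          Real.exp (-(1 * s)) * Real.exp (∑ i, -(s * h i)) := by
        rw [← Real.exp_add, Finset.sum_neg_distrib, ← Finset.mul_sum]; ring_nf
      rw [this]
      simp only [add_sub_cancel_right, Real.rpow_natCast]
      ring
    rw [setLIntegral_congr_fun (measurableSet_orthant n) h1, lintegral_const_mul _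
      (Finset.measurable_prod _ fun i _ => by fun_prop), volume_restrict_orthant,
      lintegral_fin_prod_eq_prod _
        (fun i x => ENNReal.ofReal (x ^ (((p i : ℝ) + 1) - 1) * Real.exp (-(s * x))))
        (fun i => by fun_prop)]
    have h2 : ∀ i, 0 ≤ (1 / s) ^ ((p i : ℝ) + 1) * Real.Gamma ((p i : ℝ) + 1) := fun i =>
      mul_nonneg (by positivity) (Real.Gamma_pos_of_pos (by positivity)).le
    simp_rw [lintegral_rpow_mul_exp_neg_mul_Ioi (a := (p _ : ℝ) + 1) (by positivity) hs]
    rw [← ENNReal.ofReal_prod_of_nonneg (fun i _ => h2 i), ← ENNReal.ofReal_mul (by positivity),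
      ← ENNReal.ofReal_mul (multiFact_pos p).le]
    congr 1
    rw [Finset.prod_mul_distrib]
    have h3 : ∏ i, (1 / s) ^ ((p i : ℝ) + 1) = s ^ (-((deg p : ℝ) + n)) := by
      rw [← Real.rpow_sum_of_pos (by positivity), one_div, Real.inv_rpow hs.le, ← Real.rpow_neg hs.le]
      congr 2
      simp [deg, Finset.sum_add_distrib]
    have h4 : s ^ (M - 1) * s ^ (-((deg p : ℝ) + n)) = s ^ (b - 1) := by
      rw [← Real.rpow_add hs]; congr 1; rw [hM]; ring
    simp only [Real.Gamma_nat_eq_factorial]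
    rw [h3, ← h4, multiFact]
    ring
  have h5 : ∀ h ∈ orthant n, ENNReal.ofReal (Real.Gamma M) *
      ENNReal.ofReal ((∏ i, h i ^ p i) / (1 + norm1 h) ^ M) = ∫⁻ s in Set.Ioi (0 : ℝ),
      ENNReal.ofReal ((∏ i, h i ^ p i) * (s ^ (M - 1) * Real.exp (-((1 + norm1 h) * s)))) := by
    intro h hh
    have hp : 0 ≤ ∏ i, h i ^ p i := Finset.prod_nonneg fun i _ => pow_nonneg (hh i).le _
    simp_rw [ENNReal.ofReal_mul hp]
    rw [lintegral_const_mul _ (by fun_prop),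
      lintegral_rpow_mul_exp_neg_mul_Ioi hMpos (one_add_norm1_pos h), ← ENNReal.ofReal_mul hp,
      ← ENNReal.ofReal_mul hG.le, one_div, Real.inv_rpow (one_add_norm1_pos h).le]
    congr 1
    ring
  have h6 : ENNReal.ofReal (Real.Gamma M) * ∫⁻ h in orthant n, ENNReal.ofReal ((∏ i, h i ^ p i) /
        (1 + norm1 h) ^ M) = ENNReal.ofReal (multiFact p * Real.Gamma b) := by
    rw [← lintegral_const_mul _ (by fun_prop),
      setLIntegral_congr_fun (measurableSet_orthant n) h5,
      lintegral_lintegral_swap (by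
        refine Measurable.aemeasurable ?_
        simp only [Function.uncurry_def]
        fun_prop),
      setLIntegral_congr_fun measurableSet_Ioi step, lintegral_const_mul _ (by fun_prop),
      lintegral_rpow_mul_exp_neg_mul_Ioi hb one_pos, ← ENNReal.ofReal_mul]
    · simp
    · exact Finset.prod_nonneg fun i _ => by positivity
  have h7 : ENNReal.ofReal (Real.Gamma M) ≠ 0 := by simpa using hG
  rw [ENNReal.ofReal_div_of_pos hG, ENNReal.eq_div_iff h7 ENNReal.ofReal_ne_top, h6]

theorem poch_eq_Gamma {x : ℝ} (hx : 0 < x) (k : ℕ) :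
    poch x k = Real.Gamma (x + k) / Real.Gamma x := by
  induction k with
  | zero => simp [poch, (Real.Gamma_pos_of_pos hx).ne']
  | succ k ih =>
    have h : poch x (k + 1) = poch x k * (x + k) := by
      simp [poch, ascPochhammer_succ_right]
    rw [h, ih, Nat.cast_succ, ← add_assoc, Real.Gamma_add_one (by positivity)]
    ring

/-- The series `∑ Γ(N + |p|) xᵖ / p!` converges if `x₁ + ⋯ + xₙ < 1`. -/
theorem summable_Gamma_mul_pow {n : ℕ} {N : ℝ} (hN : 0 < N) {x : Fin n → ℝ} (hx : ∀ i, 0 ≤ x i)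
    (hx1 : ∑ i, x i < 1) :
    Summable fun p : Fin n → ℕ =>
      Real.Gamma (N + deg p) / multiFact p * ∏ i, x i ^ p i := by
  have hnn : ∀ p : Fin n → ℕ, 0 ≤ Real.Gamma (N + deg p) / multiFact p * ∏ i, x i ^ p i := fun p =>
    mul_nonneg (div_nonneg (Real.Gamma_pos_of_pos (by positivity)).le (multiFact_pos p).le)
      (Finset.prod_nonneg fun i _ => pow_nonneg (hx i) _)
  have hr : 0 < 1 - ∑ i, x i := by linarith
  refine summable_of_sum_le hnn
    (c := (1 / (1 - ∑ i, x i)) ^ N * Real.Gamma N) fun u => ?_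
  rw [← ENNReal.ofReal_le_ofReal_iff (mul_nonneg (by positivity) (Real.Gamma_pos_of_pos hN).le),
    ← lintegral_rpow_mul_exp_neg_mul_Ioi hN hr, ENNReal.ofReal_sum_of_nonneg fun p _ => hnn p]
  have h1 : ∀ p : Fin n → ℕ, ENNReal.ofReal (Real.Gamma (N + deg p) / multiFact p *
      ∏ i, x i ^ p i) = ∫⁻ s in Set.Ioi (0 : ℝ), ENNReal.ofReal ((∏ i, x i ^ p i) / multiFact p) *
        ENNReal.ofReal (s ^ (N + deg p - 1) * Real.exp (-(1 * s))) := by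
    intro p
    have h0 : 0 ≤ (∏ i, x i ^ p i) / multiFact p :=
      div_nonneg (Finset.prod_nonneg fun i _ => pow_nonneg (hx i) _) (multiFact_pos p).le
    rw [lintegral_const_mul _ (by fun_prop),
      lintegral_rpow_mul_exp_neg_mul_Ioi (by positivity) one_pos, ← ENNReal.ofReal_mul h0]
    congr 1
    simp
    ring
  simp_rw [h1]
  rw [← lintegral_finsetSum _ fun p _ => by fun_prop]
  refine setLIntegral_mono (by fun_prop) fun s hs => ?_
  have hs : 0 < s := hs
  have hterm : ∀ p : Fin n → ℕ, 0 ≤ ∏ i, ((s * x i) ^ p i / (p i).factorial) := fun p =>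
    Finset.prod_nonneg fun i _ => div_nonneg (pow_nonneg (mul_nonneg hs.le (hx i)) _) (by positivity)
  have h2 : ∀ p : Fin n → ℕ, ENNReal.ofReal ((∏ i, x i ^ p i) / multiFact p) *
        ENNReal.ofReal (s ^ (N + deg p - 1) * Real.exp (-(1 * s))) =
      ENNReal.ofReal (s ^ (N - 1) * Real.exp (-(1 * s)) *
        ∏ i, ((s * x i) ^ p i / (p i).factorial)) := by
    intro p
    rw [← ENNReal.ofReal_mul
      (div_nonneg (Finset.prod_nonneg fun i _ => pow_nonneg (hx i) _) (multiFact_pos p).le)]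
    congr 1
    have : s ^ (N + deg p - 1) = s ^ (N - 1) * s ^ deg p := by
      rw [← Real.rpow_natCast, ← Real.rpow_add hs]; congr 1; ring
    rw [this, Finset.prod_div_distrib]
    simp_rw [mul_pow]
    rw [Finset.prod_mul_distrib, Finset.prod_pow_eq_pow_sum, multiFact, deg]
    ring
  simp_rw [h2]
  rw [← ENNReal.ofReal_sum_of_nonneg fun p _ => mul_nonneg (by positivity) (hterm p),
    ← Finset.mul_sum]
  refine ENNReal.ofReal_le_ofReal ?_
  have h3 : ∑ p ∈ u, ∏ i, ((s * x i) ^ p i / (p i).factorial) ≤ Real.exp (s * ∑ i, x i) := by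
    set m := (u.sup fun p => deg p) + 1
    have hsub : u ⊆ Fintype.piFinset fun _ : Fin n => Finset.range m := by
      intro p hp
      rw [Fintype.mem_piFinset]
      intro i
      have h4 : p i ≤ deg p := Finset.single_le_sum (f := p) (fun _ _ => Nat.zero_le _) (Finset.mem_univ i)
      have h5 : deg p ≤ u.sup fun p => deg p := Finset.le_sup (f := fun p => deg p) hp
      exact Finset.mem_range.2 (by omega)
    refine (Finset.sum_le_sum_of_subset_of_nonneg hsub fun p _ _ => hterm p).trans ?_
    rw [← Finset.prod_univ_sum (fun _ : Fin n => Finset.range m)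
      (fun i k => (s * x i) ^ k / (k.factorial : ℝ)), Finset.mul_sum, Real.exp_sum]
    refine Finset.prod_le_prod (fun i _ => Finset.sum_nonneg fun k _ =>
      div_nonneg (pow_nonneg (mul_nonneg hs.le (hx i)) _) (by positivity)) fun i _ => ?_
    exact Real.sum_le_exp_of_nonneg (mul_nonneg hs.le (hx i)) m
  refine (mul_le_mul_of_nonneg_left h3 (by positivity)).trans_eq ?_
  rw [mul_assoc, ← Real.exp_add]
  ring_nf

theorem cConst_pos (n : ℕ) {lam : ℝ} (hlam : -1 < lam) : 0 < cConst n lam :=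
  div_pos (Real.Gamma_pos_of_pos (by have := n.cast_nonneg (α := ℝ); linarith))
    (mul_pos (by positivity) (Real.Gamma_pos_of_pos (by linarith)))

theorem poch_pos {x : ℝ} (hx : 0 < x) (k : ℕ) : 0 < poch x k := by
  rw [poch_eq_Gamma hx]
  exact div_pos (Real.Gamma_pos_of_pos (by positivity)) (Real.Gamma_pos_of_pos hx)

theorem cConst_eq_poch (n : ℕ) {lam : ℝ} (hlam : -1 < lam) :
    cConst n lam = poch (lam + 1) n / Real.pi ^ n := by
  rw [cConst, poch_eq_Gamma (by linarith), show (n : ℝ) + lam + 1 = lam + 1 + n by ring, mul_comm,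
    div_mul_eq_div_div]

/-- The real function whose multiple by `ψ p` is the `p`-th component of `W ψ`. -/
def weightFun {n : ℕ} (lam : ℝ) (p : Fin n → ℕ) (h : Fin n → ℝ) : ℝ :=
  √((2 * Real.pi) ^ n * poch (lam + 1) (n + deg p) / (multiFact p * poch (lam + 1) n)) *
    (halfPow h p / (1 + norm1 h) ^ ((deg p : ℝ) / 2))

theorem measurable_weightFun {n : ℕ} (lam : ℝ) (p : Fin n → ℕ) : Measurable (weightFun lam p) := by
  unfold weightFun halfPow
  fun_prop

theorem measurable_density (n : ℕ) (lam : ℝ) : Measurable fun h : Fin n → ℝ =>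
    ENNReal.ofReal (cConst n lam / (2 ^ n * (1 + norm1 h) ^ ((n : ℝ) + lam + 1))) := by
  fun_prop

theorem halfPow_sq {n : ℕ} {h : Fin n → ℝ} (hh : h ∈ orthant n) (p : Fin n → ℕ) :
    halfPow h p ^ 2 = ∏ i, h i ^ p i := by
  rw [halfPow, ← Finset.prod_pow]
  refine Finset.prod_congr rfl fun i _ => ?_
  rw [← Real.rpow_natCast, ← Real.rpow_mul (hh i).le, ← Real.rpow_natCast]
  congr 1
  push_cast
  ring

theorem lintegral_weightFun_sq {n : ℕ} {lam : ℝ} (hlam : -1 < lam) (p : Fin n → ℕ) :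
    ∫⁻ h, ENNReal.ofReal (weightFun lam p h ^ 2) ∂(orthantMeasure n lam) = 1 := by
  have hb : 0 < lam + 1 := by linarith
  have hc := cConst_pos n hlam
  have hp1 := poch_pos hb (n + deg p)
  have hp2 := poch_pos hb n
  have hm := multiFact_pos p
  set K := (2 * Real.pi) ^ n * poch (lam + 1) (n + deg p) / (multiFact p * poch (lam + 1) n) with hK
  have hKpos : 0 < K := by positivity
  rw [orthantMeasure, lintegral_withDensity_eq_lintegral_mul _ (measurable_density n lam)
    (by have := measurable_weightFun lam p; fun_prop)]
  have h1 : ∀ h ∈ orthant n, ((fun h : Fin n → ℝ => ENNReal.ofReal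
      (cConst n lam / (2 ^ n * (1 + norm1 h) ^ ((n : ℝ) + lam + 1)))) *
      fun h => ENNReal.ofReal (weightFun lam p h ^ 2)) h =
      ENNReal.ofReal (cConst n lam / 2 ^ n * K) * ENNReal.ofReal ((∏ i, h i ^ p i) /
        (1 + norm1 h) ^ ((deg p : ℝ) + n + (lam + 1))) := by
    intro h hh
    have h0 := one_add_norm1_pos h
    rw [Pi.mul_apply, ← ENNReal.ofReal_mul (by positivity), ← ENNReal.ofReal_mul (by positivity)]
    congr 1
    rw [weightFun, mul_pow, Real.sq_sqrt hKpos.le, div_pow, halfPow_sq hh,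
      ← Real.rpow_natCast ((1 + norm1 h) ^ ((deg p : ℝ) / 2)), ← Real.rpow_mul h0.le,
      show (deg p : ℝ) + n + (lam + 1) = ((n : ℝ) + lam + 1) + (deg p : ℝ) / 2 * (2 : ℕ) by
        push_cast; ring, Real.rpow_add h0 ((n : ℝ) + lam + 1)]
    have hA := (Real.rpow_pos_of_pos h0 ((n : ℝ) + lam + 1)).ne'
    have hB := (Real.rpow_pos_of_pos h0 ((deg p : ℝ) / 2 * (2 : ℕ))).ne'
    generalize (1 + norm1 h) ^ ((n : ℝ) + lam + 1) = A at hA ⊢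
    generalize (1 + norm1 h) ^ ((deg p : ℝ) / 2 * (2 : ℕ)) = B at hB ⊢
    field_simp
  rw [setLIntegral_congr_fun (measurableSet_orthant n) h1, lintegral_const_mul _ (by fun_prop),
    lintegral_dirichlet hb, ← ENNReal.ofReal_mul (by positivity), ENNReal.ofReal_eq_one, hK,
    cConst_eq_poch n hlam, poch_eq_Gamma hb (n + deg p),
    show (deg p : ℝ) + n + (lam + 1) = lam + 1 + ((n + deg p : ℕ) : ℝ) by push_cast; ring]
  have h2 := (Real.Gamma_pos_of_pos hb).ne'
  have h3 := (Real.Gamma_pos_of_pos (show 0 < lam + 1 + ((n + deg p : ℕ) : ℝ) by positivity)).ne'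
  field_simp
  rw [mul_pow, mul_comm]

theorem isFiniteMeasure_orthantMeasure (n : ℕ) {lam : ℝ} (hlam : -1 < lam) :
    IsFiniteMeasure (orthantMeasure n lam) := by
  have h := lintegral_weightFun_sq hlam (0 : Fin n → ℕ)
  have h0 : ∀ h : Fin n → ℝ, weightFun lam 0 h ^ 2 = (2 * Real.pi) ^ n := by
    intro h
    have := (poch_pos (show 0 < lam + 1 by linarith) n).ne'
    simp [weightFun, deg, multiFact, halfPow, this,
      Real.sq_sqrt (by positivity : (0:ℝ) ≤ (2 * Real.pi) ^ n)]
  simp_rw [h0] at h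
  rw [lintegral_const] at h
  refine ⟨lt_top_iff_ne_top.2 fun htop => ?_⟩
  rw [htop, ENNReal.mul_top (by simp; positivity)] at h
  simp at h

theorem eLpNorm_weightFun {n : ℕ} {lam : ℝ} (hlam : -1 < lam) (p : Fin n → ℕ) :
    eLpNorm (fun h => (weightFun lam p h : ℂ)) 2 (orthantMeasure n lam) = 1 := by
  rw [eLpNorm_eq_lintegral_rpow_enorm_toReal (by simp) (by simp)]
  have : ∀ h : Fin n → ℝ, ‖(weightFun lam p h : ℂ)‖ₑ ^ (2 : ℝ≥0∞).toReal =
      ENNReal.ofReal (weightFun lam p h ^ 2) := by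
    intro h
    rw [← ofReal_norm, Complex.norm_real, ENNReal.toReal_ofNat, ENNReal.rpow_ofNat,
      ← ENNReal.ofReal_pow (norm_nonneg _), Real.norm_eq_abs, sq_abs]
  simp_rw [this]
  rw [lintegral_weightFun_sq hlam, ENNReal.one_rpow]

theorem memLp_weightFun {n : ℕ} {lam : ℝ} (hlam : -1 < lam) (p : Fin n → ℕ) :
    MemLp (fun h => (weightFun lam p h : ℂ)) 2 (orthantMeasure n lam) :=
  ⟨(Complex.measurable_ofReal.comp (measurable_weightFun lam p)).aestronglyMeasurable, by
    rw [eLpNorm_weightFun hlam]; exact ENNReal.one_lt_top⟩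

/-- The class of `weightFun` in `L²(ℝⁿ₊, ν̃_λ)`. -/
def weightVec {n : ℕ} {lam : ℝ} (hlam : -1 < lam) (p : Fin n → ℕ) : L2Orthant n lam :=
  (memLp_weightFun hlam p).toLp _

theorem norm_weightVec {n : ℕ} {lam : ℝ} (hlam : -1 < lam) (p : Fin n → ℕ) :
    ‖weightVec hlam p‖ = 1 := by
  rw [weightVec, Lp.norm_toLp, eLpNorm_weightFun hlam, ENNReal.toReal_one]

/-- The inclusion of the unit circle in `ℂ`. -/
def cval (t : Circle) : ℂ := t

@[fun_prop]
theorem continuous_cval : Continuous cval := continuous_subtype_val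

@[fun_prop]
theorem measurable_cval : Measurable cval := continuous_cval.measurable

@[simp]
theorem norm_cval (t : Circle) : ‖cval t‖ = 1 := Circle.norm_coe t

@[simp]
theorem cval_ne_zero (t : Circle) : cval t ≠ 0 := Circle.coe_ne_zero t

theorem cval_exp (θ : ℝ) : cval (Circle.exp θ) = Complex.exp (θ * Complex.I) := rfl

theorem exp_arg_cval (t : Circle) : Circle.exp (cval t).arg = t := Circle.exp_arg t

theorem conj_cval (t : Circle) : (starRingEnd ℂ) (cval t) = (cval t)⁻¹ :=
  (Circle.coe_inv_eq_conj t).symm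

@[fun_prop]
theorem measurable_circleExp : Measurable Circle.exp := Circle.exp.continuous.measurable

instance isFiniteMeasure_arcMeasure : IsFiniteMeasure arcMeasure := by
  unfold arcMeasure; infer_instance

instance isFiniteMeasure_torusMeasure (n : ℕ) : IsFiniteMeasure (torusMeasure n) := by
  unfold torusMeasure; infer_instance

theorem pi_smul_measure {n : ℕ} {E : Type*} [MeasurableSpace E] (μ : Measure E) [SigmaFinite μ]
    (c : NNReal) :
    Measure.pi (fun _ : Fin n => c • μ) = c ^ n • Measure.pi fun _ : Fin n => μ := by
  refine Measure.pi_eq fun s _ => ?_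
  simp only [Measure.smul_apply, Measure.pi_pi, ENNReal.smul_def, smul_eq_mul,
    Finset.prod_mul_distrib, Finset.prod_const, Finset.card_univ, Fintype.card_fin,
    ENNReal.coe_pow]

/-- Polar coordinates `(t, s) ↦ t √s` transport `½ dt/(it) ds` to the Lebesgue measure of `ℂ`. -/
theorem measurePreserving_mul_sqrt :
    MeasurePreserving (fun x : Circle × ℝ => cval x.1 * ((√x.2 : ℝ) : ℂ))
      (arcMeasure.prod ((2⁻¹ : NNReal) • volume.restrict (Set.Ioi 0))) volume := by
  have hm : Measurable (fun x : Circle × ℝ => cval x.1 * ((√x.2 : ℝ) : ℂ)) := by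
    refine Continuous.measurable ?_
    fun_prop
  refine ⟨hm, Measure.ext_of_lintegral _ fun f hf => ?_⟩
  have himg : (fun r : ℝ => r ^ 2) '' Set.Ioi 0 = Set.Ioi 0 := by
    ext s
    refine ⟨?_, fun hs => ⟨√s, Real.sqrt_pos.2 hs, Real.sq_sqrt (le_of_lt hs)⟩⟩
    rintro ⟨r, hr, rfl⟩
    exact pow_pos (Set.mem_Ioi.1 hr) 2
  have hsub : ∀ g : ℝ → ℝ≥0∞, Measurable g → ∫⁻ s in Set.Ioi (0 : ℝ), g (√s) =
      2 * ∫⁻ r in Set.Ioi (0 : ℝ), ENNReal.ofReal r * g r := by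
    intro g hg
    have := lintegral_image_eq_lintegral_abs_deriv_mul (s := Set.Ioi (0 : ℝ))
      (f := fun r : ℝ => r ^ 2) (f' := fun r => 2 * r) measurableSet_Ioi
      (fun r _ => by simpa using (hasDerivAt_pow 2 r).hasDerivWithinAt)
      (fun a ha b hb hab => by
        exact (pow_left_inj₀ (le_of_lt ha) (le_of_lt hb) two_ne_zero).1 hab) (fun s => g (√s))
    rw [himg] at this
    rw [this, ← lintegral_const_mul _ (by fun_prop)]
    refine setLIntegral_congr_fun measurableSet_Ioi fun r hr => ?_
    have hr : (0 : ℝ) < r := hr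
    rw [abs_of_pos (by positivity), Real.sqrt_sq hr.le, ENNReal.ofReal_mul two_pos.le, mul_assoc]
    simp
  rw [lintegral_map hf hm, lintegral_prod_symm _ (by fun_prop), lintegral_smul_measure,
    ← Complex.lintegral_comp_polarCoord_symm, polarCoord_target]
  have hinner : ∀ s : ℝ, ∫⁻ t, f (cval t * ((√s : ℝ) : ℂ)) ∂arcMeasure =
      ∫⁻ θ in Set.Ioo (-Real.pi) Real.pi, f (cval (Circle.exp θ) * ((√s : ℝ) : ℂ)) := by
    intro s
    rw [arcMeasure, lintegral_map (by
      refine hf.comp (Continuous.measurable ?_)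
      fun_prop) measurable_circleExp, Measure.restrict_congr_set Ioo_ae_eq_Ioc]
  simp_rw [hinner]
  have hmeas : Measurable fun q : ℝ × ℝ => f (cval (Circle.exp q.2) * (q.1 : ℂ)) := by
    refine hf.comp (Continuous.measurable ?_)
    fun_prop
  rw [hsub (fun r => ∫⁻ θ in Set.Ioo (-Real.pi) Real.pi, f (cval (Circle.exp θ) * (r : ℂ)))
      hmeas.lintegral_prod_right', ENNReal.smul_def, smul_eq_mul, ← mul_assoc, Measure.volume_eq_prod,
    ← Measure.prod_restrict, lintegral_prod]
  · have : ((2⁻¹ : NNReal) : ℝ≥0∞) * 2 = 1 := by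
      rw [ENNReal.coe_inv two_ne_zero]
      exact ENNReal.inv_mul_cancel (by simp) (by simp)
    rw [this, one_mul]
    refine lintegral_congr fun r => ?_
    rw [← lintegral_const_mul _ (show Measurable fun θ => f (cval (Circle.exp θ) * (r : ℂ)) from
      hmeas.comp measurable_prodMk_left)]
    refine lintegral_congr fun θ => ?_
    rw [Complex.polarCoord_symm_apply, smul_eq_mul, cval_exp, Complex.exp_mul_I,
      Complex.ofReal_cos, Complex.ofReal_sin, mul_comm (_ + _)]
  · refine Measurable.aemeasurable ?_
    simp_rw [smul_eq_mul, Complex.polarCoord_symm_apply]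
    refine Measurable.mul (by fun_prop) (hf.comp (Continuous.measurable ?_))
    fun_prop

/-- Polar coordinates `(t, s) ↦ (tᵢ √sᵢ)ᵢ` on `ℂⁿ`. -/
def polarSq {n : ℕ} (x : (Fin n → Circle) × (Fin n → ℝ)) : Fin n → ℂ :=
  fun i => cval (x.1 i) * ((√(x.2 i) : ℝ) : ℂ)

theorem continuous_polarSq {n : ℕ} : Continuous (polarSq (n := n)) := by
  unfold polarSq; fun_prop

theorem measurePreserving_polarSq (n : ℕ) :
    MeasurePreserving (polarSq (n := n)) ((torusMeasure n).prod
      ((2⁻¹ : NNReal) ^ n • volume.restrict (orthant n))) volume := by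
  have h1 := measurePreserving_pi (fun _ : Fin n => arcMeasure.prod
    ((2⁻¹ : NNReal) • (volume : Measure ℝ).restrict (Set.Ioi 0))) (fun _ => volume)
    (fun _ => measurePreserving_mul_sqrt)
  have h2 := (measurePreserving_arrowProdEquivProdArrow Circle ℝ (Fin n) (fun _ => arcMeasure)
    (fun _ => (2⁻¹ : NNReal) • (volume : Measure ℝ).restrict (Set.Ioi 0))).symm
  rw [pi_smul_measure, ← volume_restrict_orthant] at h2
  exact h1.comp h2

/-- The open simplex, image of the orthant under `h ↦ h / (1 + ‖h‖₁)`. -/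
def simplex (n : ℕ) : Set (Fin n → ℝ) := {s | (∀ i, 0 < s i) ∧ ∑ i, s i < 1}

/-- The map `h ↦ h / (1 + ∑ hᵢ)`. -/
def toSimplex {n : ℕ} (h : Fin n → ℝ) : Fin n → ℝ := (1 + ∑ i, h i)⁻¹ • h

theorem one_add_sum_pos {n : ℕ} {h : Fin n → ℝ} (hh : h ∈ orthant n) : 0 < 1 + ∑ i, h i :=
  add_pos_of_pos_of_nonneg one_pos (Finset.sum_nonneg fun i _ => (hh i).le)

theorem sum_toSimplex {n : ℕ} {h : Fin n → ℝ} (hh : h ∈ orthant n) :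
    1 - ∑ i, toSimplex h i = (1 + ∑ i, h i)⁻¹ := by
  have := (one_add_sum_pos hh).ne'
  simp only [toSimplex, Pi.smul_apply, smul_eq_mul, ← Finset.mul_sum]
  field_simp
  ring

theorem toSimplex_image_orthant (n : ℕ) : toSimplex '' orthant n = simplex n := by
  ext s
  constructor
  · rintro ⟨h, hh, rfl⟩
    refine ⟨fun i => mul_pos (inv_pos.2 (one_add_sum_pos hh)) (hh i), ?_⟩
    have := sum_toSimplex hh
    have := inv_pos.2 (one_add_sum_pos hh)
    linarith
  · rintro ⟨hs, hs1⟩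
    have hpos : 0 < 1 - ∑ i, s i := by linarith
    refine ⟨(1 - ∑ i, s i)⁻¹ • s, fun i => mul_pos (inv_pos.2 hpos) (hs i), ?_⟩
    have h1 : 1 + ∑ i, ((1 - ∑ i, s i)⁻¹ • s) i = (1 - ∑ i, s i)⁻¹ := by
      simp only [Pi.smul_apply, smul_eq_mul, ← Finset.mul_sum]
      field_simp
      ring
    rw [toSimplex, h1, inv_inv, smul_smul, mul_inv_cancel₀ hpos.ne', one_smul]

theorem toSimplex_injOn (n : ℕ) : Set.InjOn toSimplex (orthant n) := by
  intro h hh k hk hhk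
  have h1 := sum_toSimplex hh
  have h2 := sum_toSimplex hk
  rw [hhk, h2] at h1
  have h3 := hhk
  rw [toSimplex, toSimplex, h1] at h3
  exact smul_right_injective _ (inv_pos.2 (one_add_sum_pos hh)).ne' h3

/-- The linear form `v ↦ ∑ vᵢ`. -/
def sumForm (n : ℕ) : (Fin n → ℝ) →L[ℝ] ℝ := ∑ i, ContinuousLinearMap.proj i

theorem sumForm_apply {n : ℕ} (v : Fin n → ℝ) : sumForm n v = ∑ i, v i := by
  simp [sumForm]

/-- The derivative of `toSimplex`. -/
def toSimplexDeriv {n : ℕ} (h : Fin n → ℝ) : (Fin n → ℝ) →L[ℝ] (Fin n → ℝ) :=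
  (1 + ∑ i, h i)⁻¹ • (ContinuousLinearMap.id ℝ _ +
    (sumForm n).smulRight (-(1 + ∑ i, h i)⁻¹ • h))

theorem hasFDerivAt_toSimplex {n : ℕ} {h : Fin n → ℝ} (hh : h ∈ orthant n) :
    HasFDerivAt toSimplex (toSimplexDeriv h) h := by
  have h0 := (one_add_sum_pos hh).ne'
  have h1 : HasFDerivAt (fun k : Fin n → ℝ => 1 + ∑ i, k i) (sumForm n) h := by
    have := (sumForm n).hasFDerivAt (x := h) |>.const_add 1
    simpa only [sumForm_apply] using this
  have h2 := (hasDerivAt_inv h0).comp_hasFDerivAt h h1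
  have h3 := h2.smul (hasFDerivAt_id h)
  refine h3.congr_fderiv ?_
  ext v i
  simp [toSimplexDeriv]
  field_simp

theorem det_toSimplexDeriv {n : ℕ} {h : Fin n → ℝ} (hh : h ∈ orthant n) :
    (toSimplexDeriv h).det = ((1 + ∑ i, h i) ^ (n + 1))⁻¹ := by
  have h0 := (one_add_sum_pos hh).ne'
  have h1 : ((toSimplexDeriv h : (Fin n → ℝ) →L[ℝ] (Fin n → ℝ)) : (Fin n → ℝ) →ₗ[ℝ] (Fin n → ℝ)) =
      (1 + ∑ i, h i)⁻¹ • LinearMap.transvection (sumForm n : (Fin n → ℝ) →ₗ[ℝ] ℝ)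
        (-(1 + ∑ i, h i)⁻¹ • h) := by
    ext v i
    simp [toSimplexDeriv, LinearMap.transvection]
    ring
  rw [ContinuousLinearMap.det, h1, LinearMap.det_smul, LinearMap.transvection.det]
  simp only [Module.finrank_fintype_fun_eq_card, Fintype.card_fin, ContinuousLinearMap.coe_coe,
    map_smul, sumForm_apply, smul_eq_mul]
  rw [inv_pow]
  field_simp
  ring

theorem lintegral_simplex {n : ℕ} (g : (Fin n → ℝ) → ℝ≥0∞) :
    ∫⁻ s in simplex n, g s = ∫⁻ h in orthant n,
      ENNReal.ofReal (((1 + ∑ i, h i) ^ (n + 1))⁻¹) * g (toSimplex h) := by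
  rw [← toSimplex_image_orthant, lintegral_image_eq_lintegral_abs_det_fderiv_mul volume
    (measurableSet_orthant n) (fun h hh => (hasFDerivAt_toSimplex hh).hasFDerivWithinAt)
    (toSimplex_injOn n)]
  refine setLIntegral_congr_fun (measurableSet_orthant n) fun h hh => ?_
  have := one_add_sum_pos hh
  rw [det_toSimplexDeriv hh, abs_of_pos (by positivity)]

theorem measurableSet_ball (n : ℕ) : MeasurableSet (ball n) :=
  measurableSet_lt (by fun_prop) measurable_const

theorem measurableSet_simplex (n : ℕ) : MeasurableSet (simplex n) := by
  have : simplex n = orthant n ∩ {s | ∑ i, s i < 1} := rfl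
  rw [this]
  exact (measurableSet_orthant n).inter (measurableSet_lt (by fun_prop) measurable_const)

theorem kappa_apply {n : ℕ} (x : (Fin n → Circle) × (Fin n → ℝ)) (i) :
    kappa x i = cval (x.1 i) * ((√(x.2 i) / √(1 + norm1 x.2) : ℝ) : ℂ) := rfl

theorem measurable_kappa {n : ℕ} : Measurable (kappa (n := n)) := by
  refine measurable_pi_iff.2 fun i => ?_
  simp_rw [kappa_apply]
  refine Measurable.mul ?_ ?_
  · exact measurable_cval.comp ((measurable_pi_apply i).comp measurable_fst)
  · exact Complex.measurable_ofReal.comp (by fun_prop)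

theorem kappa_eq_polarSq {n : ℕ} (t : Fin n → Circle) {h : Fin n → ℝ} (hh : h ∈ orthant n) :
    kappa (t, h) = polarSq (t, toSimplex h) := by
  funext i
  simp only [kappa_apply, polarSq, toSimplex, norm1_of_mem hh, Pi.smul_apply, smul_eq_mul]
  rw [← Real.sqrt_div (hh i).le, div_eq_inv_mul]

theorem norm_polarSq_sq {n : ℕ} (t : Fin n → Circle) {s : Fin n → ℝ} (hs : ∀ i, 0 ≤ s i) (i) :
    ‖polarSq (t, s) i‖ ^ 2 = s i := by
  simp [polarSq, Real.sq_sqrt (hs i)]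

theorem measurePreserving_kappa (n : ℕ) {lam : ℝ} (hlam : -1 < lam) :
    MeasurePreserving (kappa (n := n)) (nuMeasure n lam) (vMeasure n lam) := by
  have := isFiniteMeasure_orthantMeasure n hlam
  have hc := cConst_pos n hlam
  refine ⟨measurable_kappa, Measure.ext_of_lintegral _ fun f hf => ?_⟩
  have hD : Measurable fun z : Fin n → ℂ =>
      ENNReal.ofReal (cConst n lam * (1 - ∑ i, ‖z i‖ ^ 2) ^ lam) := by fun_prop
  rw [lintegral_map hf measurable_kappa, nuMeasure, lintegral_prod
      (fun x => f (kappa x)) (hf.comp measurable_kappa).aemeasurable,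
    vMeasure, lintegral_withDensity_eq_lintegral_mul _ hD hf,
    ← lintegral_indicator (measurableSet_ball n), ← (measurePreserving_polarSq n).lintegral_comp
      ((hD.mul hf).indicator (measurableSet_ball n)), lintegral_prod
      (fun x => (ball n).indicator (_ * f) (polarSq x)) (((hD.mul hf).indicator (measurableSet_ball n)).comp
        continuous_polarSq.measurable).aemeasurable]
  refine lintegral_congr fun t => ?_
  have h1 : ∀ s ∈ orthant n, (ball n).indicator ((fun z : Fin n → ℂ =>
      ENNReal.ofReal (cConst n lam * (1 - ∑ i, ‖z i‖ ^ 2) ^ lam)) * f) (polarSq (t, s)) =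
      (simplex n).indicator (fun s => ENNReal.ofReal (cConst n lam * (1 - ∑ i, s i) ^ lam) *
        f (polarSq (t, s))) s := by
    intro s hs
    have h2 : ∑ i, ‖polarSq (t, s) i‖ ^ 2 = ∑ i, s i :=
      Finset.sum_congr rfl fun i _ => norm_polarSq_sq t (fun i => (hs i).le) i
    by_cases h3 : ∑ i, s i < 1
    · rw [Set.indicator_of_mem (show polarSq (t, s) ∈ ball n from h2.trans_lt h3),
        Set.indicator_of_mem (show s ∈ simplex n from ⟨hs, h3⟩), Pi.mul_apply, h2]
    · rw [Set.indicator_of_notMem (show polarSq (t, s) ∉ ball n from fun h4 =>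
          h3 (h2.symm.trans_lt h4)),
        Set.indicator_of_notMem (show s ∉ simplex n from fun h4 => h3 h4.2)]
  have hsub : simplex n ⊆ orthant n := fun s hs => hs.1
  rw [lintegral_smul_measure, setLIntegral_congr_fun (measurableSet_orthant n) h1,
    setLIntegral_indicator (measurableSet_simplex n), Set.inter_eq_left.2 hsub,
    lintegral_simplex, orthantMeasure, lintegral_withDensity_eq_lintegral_mul _
      (measurable_density n lam) (show Measurable fun h => f (kappa (t, h)) from
        hf.comp (measurable_kappa.comp measurable_prodMk_left)),
    ENNReal.smul_def, smul_eq_mul, ← lintegral_const_mul']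
  · refine setLIntegral_congr_fun (measurableSet_orthant n) fun h hh => ?_
    have h0 := one_add_sum_pos hh
    have h2 : (((2⁻¹ : NNReal) ^ n : NNReal) : ℝ≥0∞) = ENNReal.ofReal ((2⁻¹ : ℝ) ^ n) := by
      rw [ENNReal.ofReal, Real.toNNReal_pow (by positivity)]
      congr
      rw [Real.toNNReal_inv]
      simp
    simp only [Pi.mul_apply]
    rw [kappa_eq_polarSq t hh, sum_toSimplex hh, norm1_of_mem hh, ← mul_assoc, ← mul_assoc, h2,
      ← ENNReal.ofReal_mul (by positivity), ← ENNReal.ofReal_mul (by positivity)]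
    congr 2
    rw [Real.inv_rpow h0.le, show (n : ℝ) + lam + 1 = ((n + 1 : ℕ) : ℝ) + lam by push_cast; ring,
      Real.rpow_add h0, Real.rpow_natCast, inv_pow]
    field_simp
  · exact ENNReal.coe_ne_top

/-- A left inverse of `kappa` on the torus times the orthant. -/
def kappaInv {n : ℕ} (z : Fin n → ℂ) : (Fin n → Circle) × (Fin n → ℝ) :=
  (fun i => Circle.exp (z i).arg, fun i => ‖z i‖ ^ 2 / (1 - ∑ j, ‖z j‖ ^ 2))

theorem measurable_kappaInv {n : ℕ} : Measurable (kappaInv (n := n)) := by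
  unfold kappaInv
  refine Measurable.prodMk (measurable_pi_iff.2 fun i => ?_) (by fun_prop)
  exact measurable_circleExp.comp (Complex.measurable_arg.comp (measurable_pi_apply i))

theorem toSimplex_pos {n : ℕ} {h : Fin n → ℝ} (hh : h ∈ orthant n) (i) : 0 < toSimplex h i :=
  mul_pos (inv_pos.2 (one_add_sum_pos hh)) (hh i)

theorem sum_norm_kappa_sq {n : ℕ} (t : Fin n → Circle) {h : Fin n → ℝ} (hh : h ∈ orthant n) :
    ∑ i, ‖kappa (t, h) i‖ ^ 2 = ∑ i, toSimplex h i := by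
  rw [kappa_eq_polarSq t hh]
  exact Finset.sum_congr rfl fun i _ => norm_polarSq_sq t (fun i => (toSimplex_pos hh i).le) i

theorem kappaInv_kappa {n : ℕ} (t : Fin n → Circle) {h : Fin n → ℝ} (hh : h ∈ orthant n) :
    kappaInv (kappa (t, h)) = (t, h) := by
  have hs := toSimplex_pos hh
  have h0 := (one_add_sum_pos hh).ne'
  refine Prod.ext (funext fun i => ?_) (funext fun i => ?_)
  · simp only [kappaInv, kappa_eq_polarSq t hh, polarSq]
    rw [Complex.arg_mul_real (Real.sqrt_pos.2 (hs i)), exp_arg_cval]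
  · simp only [kappaInv]
    rw [sum_norm_kappa_sq t hh, sum_toSimplex hh, kappa_eq_polarSq t hh,
      norm_polarSq_sq t (fun i => (hs i).le)]
    simp only [toSimplex, Pi.smul_apply, smul_eq_mul]
    field_simp

theorem ae_mem_orthant (n : ℕ) (lam : ℝ) : ∀ᵐ h ∂(orthantMeasure n lam), h ∈ orthant n :=
  (withDensity_absolutelyContinuous _ _).ae_le
    ((ae_restrict_iff' (measurableSet_orthant n)).2 (.of_forall fun _ h => h))

theorem ae_snd_mem_orthant (n : ℕ) {lam : ℝ} (hlam : -1 < lam) :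
    ∀ᵐ x ∂(nuMeasure n lam), x.2 ∈ orthant n := by
  have := isFiniteMeasure_orthantMeasure n hlam
  exact Measure.quasiMeasurePreserving_snd.ae (ae_mem_orthant n lam)

/-- Composition with `kappa`, as a unitary operator. -/
theorem exists_isU0 (n : ℕ) {lam : ℝ} (hlam : -1 < lam) :
    ∃ U₀ : L2Ball n lam ≃ₗᵢ[ℂ] L2Coord n lam, IsU0 U₀ := by
  have hk := measurePreserving_kappa n hlam
  let U := Lp.compMeasurePreservingₗᵢ (E := ℂ) (p := 2) ℂ kappa hk
  have hsurj : Function.Surjective U := by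
    intro g
    have hcomp : ((g ∘ kappaInv) ∘ kappa : _ → ℂ) =ᵐ[nuMeasure n lam] g := by
      filter_upwards [ae_snd_mem_orthant n hlam] with x hx
      simp only [Function.comp_apply]
      rw [show x = (x.1, x.2) from rfl, kappaInv_kappa x.1 hx]
    have hsm : AEStronglyMeasurable (g ∘ kappaInv : _ → ℂ) (vMeasure n lam) :=
      ((Lp.stronglyMeasurable g).comp_measurable measurable_kappaInv).aestronglyMeasurable
    have hmem : MemLp (g ∘ kappaInv : _ → ℂ) 2 (vMeasure n lam) := by
      rw [← hk.map_eq, memLp_map_measure_iff (by rwa [hk.map_eq]) hk.aemeasurable]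
      exact (memLp_congr_ae hcomp).2 (Lp.memLp g)
    refine ⟨hmem.toLp _, ?_⟩
    change Lp.compMeasurePreserving kappa hk (hmem.toLp _) = g
    rw [Lp.toLp_compMeasurePreserving hmem hk]
    refine Lp.ext ((MemLp.coeFn_toLp _).trans hcomp)
  refine ⟨LinearIsometryEquiv.ofSurjective U hsurj, fun f hf => ?_⟩
  exact ⟨hf.comp_measurePreserving hk, Lp.toLp_compMeasurePreserving hf hk⟩

theorem measurePreserving_toCircle :
    MeasurePreserving (AddCircle.toCircle : UnitAddCircle → Circle) AddCircle.haarAddCircle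
      ((Real.toNNReal (2 * Real.pi)⁻¹) • arcMeasure) := by
  have hpi := Real.pi_pos
  have h1 := UnitAddCircle.measurePreserving_mk (-1 / 2)
  rw [AddCircle.volume_eq_smul_haarAddCircle, ENNReal.ofReal_one, one_smul] at h1
  have hm : Measurable (AddCircle.toCircle : UnitAddCircle → Circle) :=
    AddCircle.continuous_toCircle.measurable
  refine ⟨hm, ?_⟩
  have hemb : MeasurableEmbedding fun x : ℝ => 2 * Real.pi * x :=
    measurableEmbedding_mulLeft₀ (by positivity)
  have h2 : Measure.map (fun x : ℝ => 2 * Real.pi * x)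
      (volume.restrict (Set.Ioc (-1 / 2) (-1 / 2 + 1))) =
      Real.toNNReal (2 * Real.pi)⁻¹ • volume.restrict (Set.Ioc (-Real.pi) Real.pi) := by
    have h3 : (fun x : ℝ => 2 * Real.pi * x) ⁻¹' (Set.Ioc (-Real.pi) Real.pi) =
        Set.Ioc (-1 / 2) (-1 / 2 + 1) := by
      ext x
      simp only [Set.mem_preimage, Set.mem_Ioc]
      constructor <;> rintro ⟨ha, hb⟩ <;> constructor <;> nlinarith
    rw [← h3, ← hemb.restrict_map, Real.map_volume_mul_left (by positivity), abs_of_pos (by positivity),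
      Measure.restrict_smul]
    rfl
  rw [← h1.map_eq, Measure.map_map hm h1.measurable, arcMeasure, ← Measure.map_smul, ← h2,
    Measure.map_map measurable_circleExp hemb.measurable]
  congr 1
  funext x
  simp only [Function.comp_apply]
  rw [AddCircle.toCircle_apply_mk, div_one]

/-- The coordinatewise identification of `(ℝ/ℤ)ⁿ` with the torus. -/
def toTorus {n : ℕ} (x : UnitAddTorus (Fin n)) : Fin n → Circle := fun i => (x i).toCircle

theorem measurePreserving_toTorus (n : ℕ) :
    MeasurePreserving (toTorus (n := n)) (Measure.pi fun _ => AddCircle.haarAddCircle)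
      ((Real.toNNReal (2 * Real.pi)⁻¹) ^ n • torusMeasure n) := by
  have := measurePreserving_pi (fun _ : Fin n => (AddCircle.haarAddCircle : Measure UnitAddCircle)) _
    (fun _ => measurePreserving_toCircle)
  rw [pi_smul_measure] at this
  exact this

/-- The character `tᵖ` of the torus. -/
def torusChar {n : ℕ} (p : Fin n → ℤ) (t : Fin n → Circle) : ℂ := ∏ i, cval (t i) ^ p i

@[fun_prop]
theorem continuous_torusChar {n : ℕ} (p : Fin n → ℤ) : Continuous (torusChar p) := by
  unfold torusChar
  refine continuous_finsetProd _ fun i _ => ?_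
  exact (continuous_cval.comp (continuous_apply i)).zpow₀ _ fun t => .inl (cval_ne_zero _)

@[simp]
theorem norm_torusChar {n : ℕ} (p : Fin n → ℤ) (t : Fin n → Circle) : ‖torusChar p t‖ = 1 := by
  simp [torusChar]

theorem conj_torusChar {n : ℕ} (p : Fin n → ℤ) (t : Fin n → Circle) :
    (starRingEnd ℂ) (torusChar p t) = torusChar (-p) t := by
  simp [torusChar, conj_cval]

theorem torusChar_mul {n : ℕ} (p q : Fin n → ℤ) (t : Fin n → Circle) :
    torusChar p t * torusChar q t = torusChar (p + q) t := by
  simp only [torusChar, ← Finset.prod_mul_distrib, Pi.add_apply]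
  exact Finset.prod_congr rfl fun i _ => (zpow_add₀ (cval_ne_zero _) _ _).symm

theorem mFourier_eq_torusChar {n : ℕ} (p : Fin n → ℤ) (x : UnitAddTorus (Fin n)) :
    UnitAddTorus.mFourier p x = torusChar p (toTorus x) := by
  change ∏ i, fourier (p i) (x i) = ∏ i, cval (toTorus x i) ^ p i
  refine Finset.prod_congr rfl fun i _ => ?_
  rw [fourier_apply, AddCircle.toCircle_zsmul]
  rfl

/-- A square integrable function on the torus with zero Fourier coefficients is zero. -/
theorem ae_eq_zero_of_torusChar {n : ℕ} {f : (Fin n → Circle) → ℂ} (hf : MemLp f 2 (torusMeasure n))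
    (h0 : ∀ p : Fin n → ℤ, ∫ t, f t * torusChar (-p) t ∂(torusMeasure n) = 0) :
    f =ᵐ[torusMeasure n] 0 := by
  have hk : (Real.toNNReal (2 * Real.pi)⁻¹) ^ n ≠ 0 := by
    have : 0 < (2 * Real.pi)⁻¹ := by have := Real.pi_pos; positivity
    positivity
  have he := measurePreserving_toTorus n
  set k := (Real.toNNReal (2 * Real.pi)⁻¹) ^ n
  have hf2 : MemLp f 2 (k • torusMeasure n) := hf.smul_measure (c := (k : ℝ≥0∞)) ENNReal.coe_ne_top
  have hfe := hf2.comp_measurePreserving he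
  have hzero : hfe.toLp _ = 0 := by
    refine (UnitAddTorus.mFourierBasis.repr.map_eq_zero_iff (x := hfe.toLp _)).1 ?_
    ext p
    refine (UnitAddTorus.mFourierBasis_repr (hfe.toLp _) p).trans ?_
    have h1 : ∫ x, UnitAddTorus.mFourier (-p) x • (hfe.toLp _) x
          ∂(Measure.pi fun _ => AddCircle.haarAddCircle) =
        ∫ x, (fun t => f t * torusChar (-p) t) (toTorus x)
          ∂(Measure.pi fun _ => AddCircle.haarAddCircle) := by
      refine integral_congr_ae ?_
      filter_upwards [hfe.coeFn_toLp] with x hx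
      rw [hx, mFourier_eq_torusChar, smul_eq_mul, mul_comm]
      rfl
    have h2 : AEStronglyMeasurable (fun t => f t * torusChar (-p) t) (k • torusMeasure n) :=
      hf2.1.mul (continuous_torusChar _).aestronglyMeasurable
    refine h1.trans ((integral_map he.aemeasurable (by rw [he.map_eq]; exact h2)).symm.trans ?_)
    rw [he.map_eq, integral_smul_nnreal_measure, h0, smul_zero]
    rfl
  have h3 : eLpNorm (f ∘ toTorus) 2 (Measure.pi fun _ => AddCircle.haarAddCircle) = 0 := by
    rw [← Lp.enorm_toLp hfe, hzero, enorm_zero]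
  rw [eLpNorm_comp_measurePreserving hf2.1 he, eLpNorm_eq_zero_iff hf2.1 two_ne_zero] at h3
  exact (Measure.ae_ennreal_smul_measure_eq (c := (k : ℝ≥0∞)) (by simpa using hk)
    (torusMeasure n)).symm.le h3

theorem integral_arcMeasure (f : Circle → ℂ) (hf : Continuous f) :
    ∫ t, f t ∂arcMeasure = ∫ θ in (-Real.pi)..Real.pi, f (Circle.exp θ) := by
  rw [arcMeasure, integral_map measurable_circleExp.aemeasurable hf.aestronglyMeasurable,
    intervalIntegral.integral_of_le (by linarith [Real.pi_pos])]

theorem integral_cval_zpow (k : ℤ) :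
    ∫ t, cval t ^ k ∂arcMeasure = if k = 0 then ((2 * Real.pi : ℝ) : ℂ) else 0 := by
  rw [integral_arcMeasure _ (continuous_cval.zpow₀ _ fun t => .inl (cval_ne_zero _))]
  split_ifs with hk
  · subst hk
    simp
    ring
  · have h1 : ∀ θ : ℝ, cval (Circle.exp θ) ^ k = Complex.exp ((k * Complex.I) * θ) := by
      intro θ
      rw [cval_exp, ← Complex.exp_int_mul]
      ring_nf
    simp_rw [h1]
    rw [integral_exp_mul_complex (by simp [hk])]
    have h2 : Complex.exp (k * Complex.I * Real.pi) =
        Complex.exp (k * Complex.I * ((-Real.pi : ℝ) : ℂ)) := by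
      rw [Complex.exp_eq_exp_iff_exists_int]
      exact ⟨k, by push_cast; ring⟩
    rw [h2, sub_self, zero_div]

theorem integral_torusChar {n : ℕ} (p : Fin n → ℤ) :
    ∫ t, torusChar p t ∂(torusMeasure n) =
      if p = 0 then (((2 * Real.pi) ^ n : ℝ) : ℂ) else 0 := by
  unfold torusChar torusMeasure
  rw [integral_fintype_prod_eq_prod (fun i (t : Circle) => cval t ^ p i)]
  simp_rw [integral_cval_zpow]
  split_ifs with hp
  · subst hp
    simp
  · obtain ⟨i, hi⟩ := Function.ne_iff.1 hp
    exact Finset.prod_eq_zero (Finset.mem_univ i) (by simpa using hi)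

/-- The normalizing constant `(2π)^(-n/2)` of the Fourier transform. -/
def fourierConst (n : ℕ) : ℝ := (2 * Real.pi) ^ (-(n : ℝ) / 2)

theorem fourierConst_pos (n : ℕ) : 0 < fourierConst n :=
  Real.rpow_pos_of_pos (by have := Real.pi_pos; positivity) _

theorem fourierConst_sq_mul (n : ℕ) : fourierConst n * fourierConst n * (2 * Real.pi) ^ n = 1 := by
  have h : 0 < 2 * Real.pi := by have := Real.pi_pos; positivity
  rw [fourierConst, ← Real.rpow_natCast, ← Real.rpow_add h, ← Real.rpow_add h]
  ring_nf
  exact Real.rpow_zero _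

/-- The function `(2π)^(-n/2) tᵖ g(h)`. -/
def charMul {n : ℕ} (p : Fin n → ℤ) (g : (Fin n → ℝ) → ℂ)
    (x : (Fin n → Circle) × (Fin n → ℝ)) : ℂ :=
  (fourierConst n : ℂ) * torusChar p x.1 * g x.2

theorem norm_charMul {n : ℕ} (p : Fin n → ℤ) (g : (Fin n → ℝ) → ℂ)
    (x : (Fin n → Circle) × (Fin n → ℝ)) : ‖charMul p g x‖ = fourierConst n * ‖g x.2‖ := by
  simp [charMul, abs_of_pos (fourierConst_pos n)]

section

variable {n : ℕ} {lam : ℝ}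

theorem memLp_charMul (hlam : -1 < lam) (p : Fin n → ℤ) {g : (Fin n → ℝ) → ℂ}
    (hg : MemLp g 2 (orthantMeasure n lam)) : MemLp (charMul p g) 2 (nuMeasure n lam) := by
  have := isFiniteMeasure_orthantMeasure n hlam
  have h1 : MemLp (fun x : (Fin n → Circle) × (Fin n → ℝ) => g x.2) 2 (nuMeasure n lam) :=
    hg.comp_snd _
  refine h1.of_le_mul (c := fourierConst n) ?_ (.of_forall fun x => (norm_charMul p g x).le)
  refine AEStronglyMeasurable.mul (Continuous.aestronglyMeasurable ?_) h1.1
  fun_prop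

theorem charMul_congr (hlam : -1 < lam) (p : Fin n → ℤ) {g g' : (Fin n → ℝ) → ℂ}
    (h : g =ᵐ[orthantMeasure n lam] g') : charMul p g =ᵐ[nuMeasure n lam] charMul p g' := by
  have := isFiniteMeasure_orthantMeasure n hlam
  have h2 : ∀ᵐ x ∂(nuMeasure n lam), g x.2 = g' x.2 :=
    Measure.quasiMeasurePreserving_snd.ae h
  filter_upwards [h2] with x hx
  simp only [charMul, hx]

theorem coeFn_charMul_toLp (hlam : -1 < lam) (p : Fin n → ℤ) (g : L2Orthant n lam) :
    ((memLp_charMul hlam p (Lp.memLp g)).toLp _ : _ → ℂ) =ᵐ[nuMeasure n lam] charMul p g :=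
  MemLp.coeFn_toLp _

theorem inner_charMul (hlam : -1 < lam) (p q : Fin n → ℤ) (g k : L2Orthant n lam) :
    inner ℂ ((memLp_charMul hlam p (Lp.memLp g)).toLp _)
      ((memLp_charMul hlam q (Lp.memLp k)).toLp _) = if p = q then inner ℂ g k else 0 := by
  have := isFiniteMeasure_orthantMeasure n hlam
  rw [L2.inner_def]
  have h1 : ∫ x, inner ℂ (((memLp_charMul hlam p (Lp.memLp g)).toLp _) x)
      (((memLp_charMul hlam q (Lp.memLp k)).toLp _) x) ∂(nuMeasure n lam) =
      ∫ x, ((fourierConst n * fourierConst n : ℝ) * torusChar (q - p) x.1) * inner ℂ (g x.2) (k x.2)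
        ∂((torusMeasure n).prod (orthantMeasure n lam)) := by
    refine integral_congr_ae ?_
    filter_upwards [coeFn_charMul_toLp hlam p g, coeFn_charMul_toLp hlam q k] with x hx hy
    rw [hx, hy]
    simp only [charMul, RCLike.inner_apply, map_mul, conj_torusChar, Complex.conj_ofReal]
    rw [sub_eq_add_neg, ← torusChar_mul]
    push_cast
    ring
  rw [h1, integral_prod_mul (fun t => ((fourierConst n * fourierConst n : ℝ) : ℂ) *
    torusChar (q - p) t) (fun h => inner ℂ (g h) (k h)), ← L2.inner_def, integral_const_mul,
    integral_torusChar]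
  by_cases hpq : p = q
  · rw [if_pos hpq, if_pos (by simp [hpq]), ← Complex.ofReal_mul, fourierConst_sq_mul]
    simp
  · rw [if_neg hpq, if_neg fun h => hpq (sub_eq_zero.1 h).symm]
    simp

/-- The isometric embedding `g ↦ (2π)^(-n/2) tᵖ g(h)`. -/
def charEmb (hlam : -1 < lam) (p : Fin n → ℤ) : L2Orthant n lam →ₗᵢ[ℂ] L2Coord n lam where
  toFun g := (memLp_charMul hlam p (Lp.memLp g)).toLp _
  map_add' g k := by
    rw [← MemLp.toLp_add, MemLp.toLp_eq_toLp_iff]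
    refine (charMul_congr hlam p (Lp.coeFn_add g k)).trans (.of_forall fun x => ?_)
    simp only [charMul, Pi.add_apply]
    ring
  map_smul' c g := by
    rw [RingHom.id_apply, ← MemLp.toLp_const_smul, MemLp.toLp_eq_toLp_iff]
    refine (charMul_congr hlam p (Lp.coeFn_smul c g)).trans (.of_forall fun x => ?_)
    simp only [charMul, Pi.smul_apply, smul_eq_mul]
    ring
  norm_map' g := by
    have h := inner_charMul hlam p p g g
    rw [if_pos rfl, inner_self_eq_norm_sq_to_K, inner_self_eq_norm_sq_to_K] at h
    exact (sq_eq_sq₀ (norm_nonneg _) (norm_nonneg _)).1 (by exact_mod_cast h)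

theorem inner_charEmb (hlam : -1 < lam) (p q : Fin n → ℤ) (g k : L2Orthant n lam) :
    inner ℂ (charEmb hlam p g) (charEmb hlam q k) = if p = q then inner ℂ g k else 0 :=
  inner_charMul hlam p q g k

theorem coeFn_charEmb (hlam : -1 < lam) (p : Fin n → ℤ) (g : L2Orthant n lam) :
    (charEmb hlam p g : _ → ℂ) =ᵐ[nuMeasure n lam] charMul p g :=
  coeFn_charMul_toLp hlam p g

theorem orthogonalFamily_charEmb (hlam : -1 < lam) :
    OrthogonalFamily ℂ (fun _ : Fin n → ℤ => L2Orthant n lam) (charEmb hlam) := by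
  intro p q hpq g k
  rw [inner_charEmb, if_neg hpq]

/-- The partial Fourier coefficient `(2π)^(-n/2) ∫ f(t, h) t⁻ᵖ dt/(it)`. -/
def fourierSlice (f : (Fin n → Circle) × (Fin n → ℝ) → ℂ) (p : Fin n → ℤ) (h : Fin n → ℝ) : ℂ :=
  (fourierConst n : ℂ) * ∫ t, f (t, h) * torusChar (-p) t ∂(torusMeasure n)

theorem isFiniteMeasure_nuMeasure (n : ℕ) (hlam : -1 < lam) : IsFiniteMeasure (nuMeasure n lam) := by
  have := isFiniteMeasure_orthantMeasure n hlam
  unfold nuMeasure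
  infer_instance

theorem integrable_coord (hlam : -1 < lam) (f : L2Coord n lam) :
    Integrable f (nuMeasure n lam) := by
  have := isFiniteMeasure_nuMeasure n hlam
  exact (Lp.memLp f).integrable one_le_two

theorem integrable_mul_torusChar (hlam : -1 < lam) (f : L2Coord n lam) (p : Fin n → ℤ) :
    Integrable (fun x => f x * torusChar p x.1) (nuMeasure n lam) := by
  refine (integrable_coord hlam f).mul_bdd (c := 1) ?_ (.of_forall fun x => by simp)
  exact ((continuous_torusChar p).comp continuous_fst).aestronglyMeasurable

theorem integrable_fourierSlice (hlam : -1 < lam) (f : L2Coord n lam) (p : Fin n → ℤ) :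
    Integrable (fourierSlice f p) (orthantMeasure n lam) := by
  have := isFiniteMeasure_orthantMeasure n hlam
  exact (integrable_mul_torusChar hlam f (-p)).integral_prod_right.const_mul _

theorem inner_charEmb_indicator (hlam : -1 < lam) (f : L2Coord n lam) (p : Fin n → ℤ)
    {s : Set (Fin n → ℝ)} (hs : MeasurableSet s) (hfin : orthantMeasure n lam s ≠ ⊤) :
    inner ℂ (charEmb hlam p (indicatorConstLp 2 hs hfin (1 : ℂ))) f =
      ∫ h in s, fourierSlice f p h ∂(orthantMeasure n lam) := by
  have := isFiniteMeasure_orthantMeasure n hlam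
  rw [L2.inner_def]
  have h1 : ∫ x, inner ℂ (charEmb hlam p (indicatorConstLp 2 hs hfin (1 : ℂ)) x) (f x)
      ∂(nuMeasure n lam) = ∫ x, (Set.univ ×ˢ s).indicator
        (fun x => (fourierConst n : ℂ) * (f x * torusChar (-p) x.1)) x
        ∂((torusMeasure n).prod (orthantMeasure n lam)) := by
    refine integral_congr_ae ?_
    filter_upwards [(coeFn_charEmb hlam p _).trans
      (charMul_congr hlam p (indicatorConstLp_coeFn (p := 2) (hs := hs) (hμs := hfin) (c := (1 : ℂ))))]
      with x hx
    rw [hx]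
    by_cases hxs : x.2 ∈ s
    · rw [Set.indicator_of_mem (by simpa using hxs)]
      simp only [charMul, Set.indicator_of_mem hxs, mul_one, RCLike.inner_apply, map_mul,
        conj_torusChar, Complex.conj_ofReal]
      ring
    · rw [Set.indicator_of_notMem (by simpa using hxs)]
      simp [charMul, Set.indicator_of_notMem hxs]
  have h2 : Integrable (fun x => (fourierConst n : ℂ) * (f x * torusChar (-p) x.1))
      ((torusMeasure n).prod (orthantMeasure n lam)) :=
    (integrable_mul_torusChar hlam f (-p)).const_mul _
  rw [h1, integral_prod_symm _ (h2.indicator (MeasurableSet.univ.prod hs)), ← integral_indicator hs]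
  refine integral_congr_ae (.of_forall fun h => ?_)
  by_cases hh : h ∈ s
  · simp only [Set.indicator_of_mem hh]
    rw [fourierSlice, ← integral_const_mul]
    refine integral_congr_ae (.of_forall fun t => ?_)
    exact Set.indicator_of_mem (by simpa using hh) _
  · simp only [Set.indicator_of_notMem hh]
    refine integral_eq_zero_of_ae (.of_forall fun t => ?_)
    exact Set.indicator_of_notMem (by simpa using hh) _

theorem ae_memLp_slice (hlam : -1 < lam) (f : L2Coord n lam) :
    ∀ᵐ h ∂(orthantMeasure n lam), MemLp (fun t => f (t, h)) 2 (torusMeasure n) := by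
  have := isFiniteMeasure_orthantMeasure n hlam
  have hsm := Lp.stronglyMeasurable f
  have h1 : Integrable (fun x => ‖f x‖ ^ 2) ((torusMeasure n).prod (orthantMeasure n lam)) :=
    (memLp_two_iff_integrable_sq_norm hsm.aestronglyMeasurable).1 (Lp.memLp f)
  filter_upwards [h1.prod_left_ae] with h hh
  exact (memLp_two_iff_integrable_sq_norm
    (hsm.comp_measurable measurable_prodMk_right).aestronglyMeasurable).2 hh

theorem isHilbertSum_charEmb (hlam : -1 < lam) :
    IsHilbertSum ℂ (fun _ : Fin n → ℤ => L2Orthant n lam) (charEmb hlam) := by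
  have := isFiniteMeasure_orthantMeasure n hlam
  refine IsHilbertSum.mk (orthogonalFamily_charEmb hlam) ?_
  rw [top_le_iff, Submodule.topologicalClosure_eq_top_iff, Submodule.eq_bot_iff]
  intro f hf
  have h1 : ∀ p : Fin n → ℤ, fourierSlice f p =ᵐ[orthantMeasure n lam] 0 := by
    intro p
    refine Integrable.ae_eq_zero_of_forall_setIntegral_eq_zero (integrable_fourierSlice hlam f p)
      fun s hs hfin => ?_
    rw [← inner_charEmb_indicator hlam f p hs hfin.ne]
    exact hf _ (Submodule.mem_iSup_of_mem p ⟨_, rfl⟩)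
  have h2 : ∀ᵐ h ∂(orthantMeasure n lam), ∀ᵐ t ∂(torusMeasure n), f (t, h) = 0 := by
    filter_upwards [ae_all_iff.2 h1, ae_memLp_slice hlam f] with h hh hmem
    refine ae_eq_zero_of_torusChar hmem fun p => ?_
    have := hh p
    rw [fourierSlice, Pi.zero_apply, mul_eq_zero] at this
    exact this.resolve_left (by exact_mod_cast (fourierConst_pos n).ne')
  have hset : MeasurableSet {x | f x = 0} :=
    (Lp.stronglyMeasurable f).measurable (measurableSet_singleton 0)
  rw [Lp.eq_zero_iff_ae_eq_zero]
  have h3 : ∀ᵐ x ∂((torusMeasure n).prod (orthantMeasure n lam)), f x = 0 :=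
    (Measure.ae_prod_iff_ae_ae hset).2 ((Measure.ae_ae_comm hset).2 h2)
  exact h3

/-- The Fourier transform in the torus variable, as a unitary operator. -/
def fourierEquiv (hlam : -1 < lam) : L2Coord n lam ≃ₗᵢ[ℂ] SeqL2Orthant n lam :=
  (isHilbertSum_charEmb hlam).linearIsometryEquiv

theorem fourierEquiv_symm_single (hlam : -1 < lam) (p : Fin n → ℤ) (g : L2Orthant n lam) :
    (fourierEquiv hlam).symm (lp.single 2 p g) = charEmb hlam p g :=
  (isHilbertSum_charEmb hlam).linearIsometryEquiv_symm_apply_single g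

theorem inner_fourierEquiv_apply (hlam : -1 < lam) (f : L2Coord n lam) (p : Fin n → ℤ)
    (g : L2Orthant n lam) :
    inner ℂ g (fourierEquiv hlam f p) = inner ℂ (charEmb hlam p g) f := by
  refine (lp.inner_single_left (𝕜 := ℂ) (G := fun _ : Fin n → ℤ => L2Orthant n lam) p g _).symm.trans ?_
  rw [← fourierEquiv_symm_single, ← LinearIsometryEquiv.inner_map_map (fourierEquiv hlam),
    LinearIsometryEquiv.apply_symm_apply]

theorem isU1_fourierEquiv (hlam : -1 < lam) : IsU1 (fourierEquiv (n := n) hlam) := by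
  have := isFiniteMeasure_orthantMeasure n hlam
  intro f p
  change _ =ᵐ[orthantMeasure n lam] fourierSlice f p
  refine Integrable.ae_eq_of_forall_setIntegral_eq _ _
    ((Lp.memLp _).integrable one_le_two) (integrable_fourierSlice hlam f p) fun s hs hfin => ?_
  rw [← inner_charEmb_indicator hlam f p hs hfin.ne, ← inner_fourierEquiv_apply,
    L2.inner_indicatorConstLp_one]

end

/-- The inclusion of `ℤⁿ₊` in `ℤⁿ`. -/
def natIncl {n : ℕ} (p : Fin n → ℕ) : Fin n → ℤ := fun i => (p i : ℤ)

theorem natIncl_injective {n : ℕ} : Function.Injective (natIncl (n := n)) := fun _ _ h =>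
  funext fun i => Int.ofNat_inj.1 (congrFun h i)

section

variable {n : ℕ} {lam : ℝ}

/-- The image under `W` of the `p`-th basis vector of `ℓ²(ℤⁿ₊)`. -/
def weightSeq (hlam : -1 < lam) (p : Fin n → ℕ) : SeqL2Orthant n lam :=
  lp.single 2 (natIncl p) (weightVec hlam p)

theorem inner_weightSeq_left (hlam : -1 < lam) (p : Fin n → ℕ) (φ : SeqL2Orthant n lam) :
    inner ℂ (weightSeq hlam p) φ = inner ℂ (weightVec hlam p) (φ (natIncl p)) :=
  lp.inner_single_left (𝕜 := ℂ) (G := fun _ : Fin n → ℤ => L2Orthant n lam) _ _ _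

theorem weightSeq_apply_self (hlam : -1 < lam) (p : Fin n → ℕ) :
    weightSeq hlam p (natIncl p) = weightVec hlam p :=
  lp.single_apply_self (E := fun _ : Fin n → ℤ => L2Orthant n lam) 2 (natIncl p) _

theorem weightSeq_apply_ne (hlam : -1 < lam) (p : Fin n → ℕ) {q : Fin n → ℤ} (hq : q ≠ natIncl p) :
    weightSeq hlam p q = 0 :=
  lp.single_apply_ne (E := fun _ : Fin n → ℤ => L2Orthant n lam) 2 (natIncl p) _ hq

theorem orthonormal_weightSeq (hlam : -1 < lam) : Orthonormal ℂ (weightSeq (n := n) hlam) := by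
  refine ⟨fun p => ?_, fun p q hpq => ?_⟩
  · exact (lp.norm_single (E := fun _ : Fin n → ℤ => L2Orthant n lam) two_pos _ _).trans
      (norm_weightVec hlam p)
  · change inner ℂ (weightSeq hlam p) (weightSeq hlam q) = 0
    rw [inner_weightSeq_left, weightSeq_apply_ne hlam q fun h => hpq (natIncl_injective h),
      inner_zero_right]

/-- The isometry `W`. -/
def weightIsometry (hlam : -1 < lam) : SeqNat n →ₗᵢ[ℂ] SeqL2Orthant n lam :=
  (orthonormal_weightSeq hlam).orthogonalFamily.linearIsometry

theorem hasSum_weightIsometry (hlam : -1 < lam) (ψ : SeqNat n) :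
    HasSum (fun p => ψ p • weightSeq hlam p) (weightIsometry hlam ψ) :=
  (orthonormal_weightSeq hlam).orthogonalFamily.hasSum_linearIsometry ψ

theorem hasSum_weightIsometry_apply (hlam : -1 < lam) (ψ : SeqNat n) (q : Fin n → ℤ) :
    HasSum (fun p => ψ p • weightSeq hlam p q) (weightIsometry hlam ψ q) :=
  (hasSum_weightIsometry hlam ψ).mapL
    (lp.evalCLM ℂ (fun _ : Fin n → ℤ => L2Orthant n lam) 2 q)

theorem weightIsometry_apply_natIncl (hlam : -1 < lam) (ψ : SeqNat n) (p : Fin n → ℕ) :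
    weightIsometry hlam ψ (natIncl p) = ψ p • weightVec hlam p := by
  have h : HasSum (fun q => ψ q • weightSeq hlam q (natIncl p))
      (ψ p • weightSeq hlam p (natIncl p)) := by
    refine hasSum_single p fun q hq => ?_
    rw [weightSeq_apply_ne hlam q fun h => hq (natIncl_injective h).symm, smul_zero]
  rw [weightSeq_apply_self] at h
  exact (hasSum_weightIsometry_apply hlam ψ _).unique h

theorem weightIsometry_apply_of_neg (hlam : -1 < lam) (ψ : SeqNat n) {q : Fin n → ℤ}
    (hq : ∃ i, q i < 0) : weightIsometry hlam ψ q = 0 := by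
  have h : HasSum (fun p => ψ p • weightSeq hlam p q) 0 := by
    convert hasSum_zero with p
    rw [weightSeq_apply_ne hlam p, smul_zero]
    rintro rfl
    obtain ⟨i, hi⟩ := hq
    exact absurd hi (not_lt.2 (Int.natCast_nonneg _))
  exact (hasSum_weightIsometry_apply hlam ψ _).unique h

theorem coeFn_weightVec (hlam : -1 < lam) (p : Fin n → ℕ) :
    (weightVec hlam p : _ → ℂ) =ᵐ[orthantMeasure n lam] fun h => (weightFun lam p h : ℂ) :=
  MemLp.coeFn_toLp _

theorem isW_weightIsometry (hlam : -1 < lam) : IsW (weightIsometry (n := n) hlam) := by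
  refine fun ψ => ⟨fun p => ?_, fun q hq => weightIsometry_apply_of_neg hlam ψ hq⟩
  have h := weightIsometry_apply_natIncl hlam ψ p
  change (weightIsometry hlam ψ (natIncl p) : (Fin n → ℝ) → ℂ) =ᵐ[orthantMeasure n lam]
    fun h => (weightFun lam p h : ℂ) * ψ p
  rw [h]
  filter_upwards [Lp.coeFn_smul (ψ p) (weightVec hlam p), coeFn_weightVec hlam p] with x hx hy
  rw [hx, Pi.smul_apply, hy, smul_eq_mul, mul_comm]

theorem weightIsometry_single (hlam : -1 < lam) (p : Fin n → ℕ) :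
    weightIsometry hlam (lp.single 2 p (1 : ℂ)) = weightSeq hlam p := by
  refine ((orthonormal_weightSeq hlam).orthogonalFamily.linearIsometry_apply_single
    (1 : ℂ)).trans ?_
  simp

theorem adjoint_weightIsometry_apply (hlam : -1 < lam) (φ : SeqL2Orthant n lam) (p : Fin n → ℕ) :
    ContinuousLinearMap.adjoint (weightIsometry hlam).toContinuousLinearMap φ p =
      inner ℂ (weightVec hlam p) (φ (natIncl p)) := by
  rw [← inner_weightSeq_left, ← weightIsometry_single]
  have h1 := ContinuousLinearMap.adjoint_inner_right (weightIsometry hlam).toContinuousLinearMap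
    (lp.single 2 p (1 : ℂ)) φ
  refine Eq.trans ?_ h1
  have h2 := lp.inner_single_left (𝕜 := ℂ) (G := fun _ : Fin n → ℕ => ℂ) p 1
    (ContinuousLinearMap.adjoint (weightIsometry hlam).toContinuousLinearMap φ)
  refine Eq.trans ?_ h2.symm
  simp

theorem density_mul_weightFun (hlam : -1 < lam) (p : Fin n → ℕ) (h : Fin n → ℝ) :
    cConst n lam / (2 ^ n * (1 + norm1 h) ^ ((n : ℝ) + lam + 1)) * weightFun lam p h =
      √(poch (lam + 1) n * poch (lam + 1) (n + deg p) / ((2 * Real.pi) ^ n * multiFact p)) *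
        (halfPow h p / (1 + norm1 h) ^ ((deg p : ℝ) / 2 + n + lam + 1)) := by
  have hb : 0 < lam + 1 := by linarith
  have hp1 := poch_pos hb (n + deg p)
  have hp2 := poch_pos hb n
  have hm := multiFact_pos p
  have hpi := Real.pi_pos
  have h0 := one_add_norm1_pos h
  have hsq : √(poch (lam + 1) n * poch (lam + 1) (n + deg p) / ((2 * Real.pi) ^ n * multiFact p)) =
      poch (lam + 1) n / (2 * Real.pi) ^ n *
      √((2 * Real.pi) ^ n * poch (lam + 1) (n + deg p) / (multiFact p * poch (lam + 1) n)) := by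
    rw [Real.sqrt_eq_iff_mul_self_eq (by positivity) (by positivity), mul_mul_mul_comm,
      Real.mul_self_sqrt (by positivity)]
    field_simp
  rw [hsq, weightFun, cConst_eq_poch n hlam,
    show (deg p : ℝ) / 2 + n + lam + 1 = ((n : ℝ) + lam + 1) + (deg p : ℝ) / 2 by ring,
    Real.rpow_add h0 ((n : ℝ) + lam + 1), mul_pow]
  have hA := (Real.rpow_pos_of_pos h0 ((n : ℝ) + lam + 1)).ne'
  have hB := (Real.rpow_pos_of_pos h0 ((deg p : ℝ) / 2)).ne'
  generalize (1 + norm1 h) ^ ((n : ℝ) + lam + 1) = A at hA ⊢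
  generalize (1 + norm1 h) ^ ((deg p : ℝ) / 2) = B at hB ⊢
  field_simp

theorem adjoint_formula (hlam : -1 < lam) (φ : SeqL2Orthant n lam) (p : Fin n → ℕ) :
    IntegrableOn (adjointIntegrand φ p) (orthant n) ∧
      ContinuousLinearMap.adjoint (weightIsometry hlam).toContinuousLinearMap φ p =
        ((√(poch (lam + 1) n * poch (lam + 1) (n + deg p) /
            ((2 * Real.pi) ^ n * multiFact p)) : ℝ) : ℂ) *
          ∫ h in orthant n, adjointIntegrand φ p h := by
  have hb : 0 < lam + 1 := by linarith
  have hc := cConst_pos n hlam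
  have hK : 0 < √(poch (lam + 1) n * poch (lam + 1) (n + deg p) /
      ((2 * Real.pi) ^ n * multiFact p)) := by
    have hp1 := poch_pos hb (n + deg p)
    have hp2 := poch_pos hb n
    have hm := multiFact_pos p
    have hpi := Real.pi_pos
    positivity
  set K := √(poch (lam + 1) n * poch (lam + 1) (n + deg p) / ((2 * Real.pi) ^ n * multiFact p))
    with hKdef
  set D : (Fin n → ℝ) → ℝ≥0∞ := fun h =>
    ENNReal.ofReal (cConst n lam / (2 ^ n * (1 + norm1 h) ^ ((n : ℝ) + lam + 1)))
  have hDlt : ∀ᵐ h ∂(volume.restrict (orthant n)), D h < ⊤ := .of_forall fun h => ENNReal.ofReal_lt_top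
  have hpt : ∀ h, (D h).toReal • (inner ℂ ((weightFun lam p h : ℂ)) (φ (natIncl p) h)) =
      (K : ℂ) * adjointIntegrand φ p h := by
    intro h
    have h0 := one_add_norm1_pos h
    have hd : (D h).toReal = cConst n lam / (2 ^ n * (1 + norm1 h) ^ ((n : ℝ) + lam + 1)) :=
      ENNReal.toReal_ofReal (by positivity)
    have hmul := density_mul_weightFun hlam p h
    rw [← hd, ← hKdef] at hmul
    have hmul' := congrArg (fun x : ℝ => (x : ℂ)) hmul
    simp only [Complex.ofReal_mul] at hmul'
    rw [adjointIntegrand, ← mul_assoc, ← hmul', RCLike.inner_apply, Complex.conj_ofReal,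
      Complex.real_smul, mul_assoc, mul_comm (weightFun lam p h : ℂ)]
    rfl
  have hae : (fun h => inner ℂ (weightVec hlam p h) (φ (natIncl p) h)) =ᵐ[orthantMeasure n lam]
      fun h => inner ℂ ((weightFun lam p h : ℂ)) (φ (natIncl p) h) := by
    filter_upwards [coeFn_weightVec hlam p] with h hh
    rw [hh]
  have hint : Integrable (fun h => inner ℂ ((weightFun lam p h : ℂ)) (φ (natIncl p) h))
      (orthantMeasure n lam) :=
    (L2.integrable_inner (𝕜 := ℂ) (weightVec hlam p) (φ (natIncl p))).congr hae
  constructor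
  · have h1 := (integrable_withDensity_iff_integrable_smul' (measurable_density n lam) hDlt).1 hint
    have h2 : Integrable (fun h => (K : ℂ)⁻¹ * ((K : ℂ) * adjointIntegrand φ p h))
        (volume.restrict (orthant n)) :=
      (h1.congr (.of_forall hpt)).const_mul _
    refine h2.congr (.of_forall fun h => ?_)
    have : (K : ℂ) ≠ 0 := by exact_mod_cast hK.ne'
    field_simp
  · have h3 : ∫ h, inner ℂ ((weightFun lam p h : ℂ)) (φ (natIncl p) h) ∂(orthantMeasure n lam) =
        ∫ h in orthant n, (D h).toReal • inner ℂ ((weightFun lam p h : ℂ)) (φ (natIncl p) h) :=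
      integral_withDensity_eq_integral_toReal_smul (measurable_density n lam) hDlt _
    rw [adjoint_weightIsometry_apply, L2.inner_def, integral_congr_ae hae, h3, ← integral_const_mul]
    exact integral_congr_ae (.of_forall hpt)

end

theorem integral_arcMeasure_eq_circleMap {F : ℂ → ℂ} {s : ℝ}
    (hF : Continuous fun t : Circle => F (cval t * s)) :
    ∫ t, F (cval t * s) ∂arcMeasure = ∫ θ in (0 : ℝ)..2 * Real.pi, F (circleMap 0 s θ) := by
  have h1 : ∀ θ : ℝ, F (cval (Circle.exp θ) * s) = F (circleMap 0 s θ) := fun θ => by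
    rw [cval_exp, circleMap, zero_add, mul_comm]
  have hper : Function.Periodic (fun θ => F (circleMap 0 s θ)) (2 * Real.pi) := fun θ => by
    simp only [periodic_circleMap 0 s θ]
  have h2 := hper.intervalIntegral_add_eq (-Real.pi) 0
  rw [integral_arcMeasure _ hF]
  simp_rw [h1]
  rw [zero_add, show -Real.pi + 2 * Real.pi = Real.pi by ring] at h2
  exact h2

theorem circleIntegral_mul_zpow {g : ℂ → ℂ} {s : ℝ} (hs : 0 < s) (k : ℤ)
    (hg : ∀ z, ‖z‖ ≤ s → DifferentiableAt ℂ g z) :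
    (∮ z in C(0, s), g z * z ^ (-k - 1)) =
      Complex.I * ((∫ t, g (cval t * s) * cval t ^ (-k) ∂arcMeasure) * (s : ℂ) ^ (-k)) := by
  have hs0 : (s : ℂ) ≠ 0 := by exact_mod_cast hs.ne'
  have hcont : Continuous fun t : Circle => g (cval t * s) :=
    continuous_iff_continuousAt.2 fun t =>
      ContinuousAt.comp (g := g) (hg _ (by simp [abs_of_pos hs])).continuousAt
        (by fun_prop)
  have hcont2 : Continuous fun t : Circle => (cval t * (s : ℂ)) ^ (-k) :=
    Continuous.zpow₀ (by fun_prop) _ fun t => .inl (mul_ne_zero (cval_ne_zero t) hs0)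
  have h1 := integral_arcMeasure_eq_circleMap (F := fun z => g z * z ^ (-k)) (s := s)
    (hcont.mul hcont2)
  have h2 : ∫ t, g (cval t * s) * (cval t * (s : ℂ)) ^ (-k) ∂arcMeasure =
      (∫ t, g (cval t * s) * cval t ^ (-k) ∂arcMeasure) * (s : ℂ) ^ (-k) := by
    rw [← integral_mul_const]
    refine integral_congr_ae (.of_forall fun t => ?_)
    simp only [mul_zpow]
    ring
  rw [← h2, h1, circleIntegral, ← intervalIntegral.integral_const_mul]
  refine intervalIntegral.integral_congr fun θ _ => ?_
  have h3 : circleMap 0 s θ ≠ 0 := circleMap_ne_center hs.ne'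
  simp only [deriv_circleMap, smul_eq_mul]
  rw [zpow_sub_one₀ h3]
  field_simp

/-- Laurent coefficients computed on two concentric circles agree. -/
theorem integral_arc_zpow_invariant {g : ℂ → ℂ} {s s' : ℝ} (hs : 0 < s) (hss' : s ≤ s') (k : ℤ)
    (hg : ∀ z, ‖z‖ ≤ s' → DifferentiableAt ℂ g z) :
    (∫ t, g (cval t * s) * cval t ^ (-k) ∂arcMeasure) * (s : ℂ) ^ (-k) =
      (∫ t, g (cval t * s') * cval t ^ (-k) ∂arcMeasure) * (s' : ℂ) ^ (-k) := by
  have h1 := circleIntegral_mul_zpow hs k fun z hz => hg z (hz.trans hss')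
  have h2 := circleIntegral_mul_zpow (hs.trans_le hss') k hg
  have hd : ∀ z : ℂ, z ≠ 0 → ‖z‖ ≤ s' → DifferentiableAt ℂ (fun z => g z * z ^ (-k - 1)) z :=
    fun z hz hzs => (hg z hzs).mul (differentiableAt_zpow.2 (.inl hz))
  have h3 := Complex.circleIntegral_eq_of_differentiable_on_annulus_off_countable (c := 0) hs hss'
    (f := fun z => g z * z ^ (-k - 1)) Set.countable_empty
    (fun z hz => (hd z (by rintro rfl; simp [hs] at hz)
      (by simpa using hz.1)).continuousAt.continuousWithinAt)
    (fun z hz => hd z (by rintro rfl; simp [hs.le] at hz)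
      (by simpa using (Metric.ball_subset_closedBall hz.1.1)))
  rw [h1, h2] at h3
  exact (mul_left_cancel₀ Complex.I_ne_zero h3).symm

theorem integral_arc_zpow_eq_zero {g : ℂ → ℂ} {s : ℝ} (hs : 0 < s) {k : ℤ} (hk : k < 0)
    (hg : ∀ z, ‖z‖ ≤ s → DifferentiableAt ℂ g z) :
    ∫ t, g (cval t * s) * cval t ^ (-k) ∂arcMeasure = 0 := by
  have h1 := circleIntegral_mul_zpow hs k hg
  have hd : ∀ z : ℂ, ‖z‖ ≤ s → DifferentiableAt ℂ (fun z => g z * z ^ (-k - 1)) z :=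
    fun z hzs => (hg z hzs).mul (differentiableAt_zpow.2 (.inr (by omega)))
  rw [Complex.circleIntegral_eq_zero_of_differentiable_on_off_countable hs.le Set.countable_empty
    (fun z hz => (hd z (by simpa using hz)).continuousAt.continuousWithinAt)
    (fun z hz => hd z (by simpa using (Metric.ball_subset_closedBall hz.1)))] at h1
  have h2 : (s : ℂ) ^ (-k) ≠ 0 := zpow_ne_zero _ (by exact_mod_cast hs.ne')
  have h3 := (mul_eq_zero.1 h1.symm).resolve_left Complex.I_ne_zero
  exact (mul_eq_zero.1 h3).resolve_right h2

theorem integral_torus_insertNth {m : ℕ} (j : Fin (m + 1)) {F : (Fin (m + 1) → Circle) → ℂ}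
    (hF : Continuous F) :
    ∫ t, F t ∂(torusMeasure (m + 1)) =
      ∫ t', ∫ u, F (j.insertNth (α := fun _ => Circle) u t') ∂arcMeasure ∂(torusMeasure m) := by
  have hmp := (measurePreserving_piFinSuccAbove (fun _ : Fin (m + 1) => arcMeasure) j).symm
  have hins : Continuous fun x : Circle × (Fin m → Circle) =>
      j.insertNth (α := fun _ => Circle) x.1 x.2 :=
    Continuous.finInsertNth j continuous_fst continuous_snd
  have h1 : ∫ x, F (j.insertNth (α := fun _ => Circle) x.1 x.2)
      ∂(arcMeasure.prod (torusMeasure m)) = ∫ t, F t ∂(torusMeasure (m + 1)) :=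
    hmp.integral_comp (MeasurableEquiv.measurableEmbedding _) F
  have hint : Integrable (fun x : Circle × (Fin m → Circle) =>
      F (j.insertNth (α := fun _ => Circle) x.1 x.2)) (arcMeasure.prod (torusMeasure m)) :=
    (hF.comp hins).integrable_of_hasCompactSupport (HasCompactSupport.of_compactSpace _)
  rw [← h1, integral_prod_symm _ hint]

/-- The radii of the tori contained in the ball. -/
def IsRadius {n : ℕ} (r : Fin n → ℝ) : Prop := (∀ i, 0 < r i) ∧ ∑ i, r i ^ 2 < 1

/-- The point `(tᵢ rᵢ)ᵢ`. -/
def torusPoint {n : ℕ} (r : Fin n → ℝ) (t : Fin n → Circle) : Fin n → ℂ :=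
  fun i => cval (t i) * (r i : ℂ)

theorem torusPoint_mem {n : ℕ} {r : Fin n → ℝ} (hr : IsRadius r) (t : Fin n → Circle) :
    torusPoint r t ∈ ball n := by
  have : ∑ i, ‖torusPoint r t i‖ ^ 2 = ∑ i, r i ^ 2 :=
    Finset.sum_congr rfl fun i _ => by simp [torusPoint]
  exact this.trans_lt hr.2

theorem isOpen_ball (n : ℕ) : IsOpen (ball n) :=
  isOpen_lt (by fun_prop) continuous_const

section

variable {n : ℕ} {f : (Fin n → ℂ) → ℂ}

/-- The Fourier coefficient of `f` on the torus of radii `r`. -/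
def torusCoeff (f : (Fin n → ℂ) → ℂ) (p : Fin n → ℤ) (r : Fin n → ℝ) : ℂ :=
  ∫ t, f (torusPoint r t) * torusChar (-p) t ∂(torusMeasure n)

theorem continuous_torusCoeff_integrand (hf : DifferentiableOn ℂ f (ball n)) (p : Fin n → ℤ)
    {r : Fin n → ℝ} (hr : IsRadius r) :
    Continuous fun t => f (torusPoint r t) * torusChar (-p) t := by
  refine Continuous.mul ?_ (continuous_torusChar _)
  refine hf.continuousOn.comp_continuous ?_ (torusPoint_mem hr)
  unfold torusPoint
  fun_prop

theorem torusPoint_insertNth {m : ℕ} (j : Fin (m + 1)) (r : Fin (m + 1) → ℝ) (u : Circle)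
    (t : Fin m → Circle) : torusPoint r (j.insertNth (α := fun _ => Circle) u t) =
      j.insertNth (α := fun _ => ℂ) (cval u * (r j : ℂ))
        (torusPoint (fun i => r (j.succAbove i)) t) := by
  refine (Fin.insertNth_eq_iff (α := fun _ => ℂ)).2 ⟨?_, ?_⟩ |>.symm
  · simp [torusPoint]
  · funext i
    simp [torusPoint, Fin.removeNth]

theorem torusChar_insertNth {m : ℕ} (j : Fin (m + 1)) (p : Fin (m + 1) → ℤ) (u : Circle)
    (t : Fin m → Circle) : torusChar p (j.insertNth (α := fun _ => Circle) u t) =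
      cval u ^ p j * torusChar (fun i => p (j.succAbove i)) t := by
  rw [torusChar, Fin.prod_univ_succAbove _ j]
  simp [torusChar]

theorem torusCoeff_succ {m : ℕ} {f : (Fin (m + 1) → ℂ) → ℂ}
    (hf : DifferentiableOn ℂ f (ball (m + 1))) (p : Fin (m + 1) → ℤ) (j : Fin (m + 1))
    {r : Fin (m + 1) → ℝ} (hr : IsRadius r) :
    torusCoeff f p r = ∫ t, (∫ u, f (j.insertNth (α := fun _ => ℂ) (cval u * (r j : ℂ))
        (torusPoint (fun i => r (j.succAbove i)) t)) * cval u ^ (-p j) ∂arcMeasure) *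
      torusChar (fun i => -p (j.succAbove i)) t ∂(torusMeasure m) := by
  rw [torusCoeff, integral_torus_insertNth j (continuous_torusCoeff_integrand hf p hr)]
  refine integral_congr_ae (.of_forall fun t => ?_)
  simp only
  rw [← integral_mul_const]
  refine integral_congr_ae (.of_forall fun u => ?_)
  simp only
  rw [torusPoint_insertNth, torusChar_insertNth, ← mul_assoc]
  rfl

theorem differentiableAt_insertNth {m : ℕ} {f : (Fin (m + 1) → ℂ) → ℂ}
    (hf : DifferentiableOn ℂ f (ball (m + 1))) (j : Fin (m + 1))
    {r : Fin (m + 1) → ℝ} (hr : IsRadius r) (t : Fin m → Circle) {z : ℂ} (hz : ‖z‖ ≤ r j) :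
    DifferentiableAt ℂ (fun z => f (j.insertNth (α := fun _ => ℂ) z
      (torusPoint (fun i => r (j.succAbove i)) t))) z := by
  have hmem : j.insertNth (α := fun _ => ℂ) z (torusPoint (fun i => r (j.succAbove i)) t) ∈
      ball (m + 1) := by
    refine lt_of_le_of_lt ?_ hr.2
    rw [Fin.sum_univ_succAbove _ j, Fin.sum_univ_succAbove _ j]
    simp only [Fin.insertNth_apply_same, Fin.insertNth_apply_succAbove]
    refine add_le_add (pow_le_pow_left₀ (norm_nonneg _) hz 2) (Finset.sum_le_sum fun i _ => ?_)
    simp [torusPoint]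
  refine DifferentiableAt.comp (g := f) z
    ((hf _ hmem).differentiableAt ((isOpen_ball _).mem_nhds hmem)) ?_
  rw [differentiableAt_pi]
  intro i
  rcases Fin.eq_self_or_eq_succAbove j i with rfl | ⟨k, rfl⟩
  · simp
  · simp

/-- The torus coefficient divided by the monomial `rᵖ`. -/
def normCoeff (f : (Fin n → ℂ) → ℂ) (p : Fin n → ℤ) (r : Fin n → ℝ) : ℂ :=
  torusCoeff f p r * ∏ i, (r i : ℂ) ^ (-p i)

theorem isRadius_mono {r s : Fin n → ℝ} (hr : IsRadius r) (hs : ∀ i, 0 < s i)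
    (hsr : ∀ i, s i ≤ r i) : IsRadius s :=
  ⟨hs, (Finset.sum_le_sum fun i _ => pow_le_pow_left₀ (hs i).le (hsr i) 2).trans_lt hr.2⟩

theorem normCoeff_update (hf : DifferentiableOn ℂ f (ball n)) (p : Fin n → ℤ)
    {r : Fin n → ℝ} (hr : IsRadius r) (j : Fin n) {s : ℝ} (hs : 0 < s) (hsr : s ≤ r j) :
    normCoeff f p (Function.update r j s) = normCoeff f p r := by
  cases n with
  | zero => exact j.elim0
  | succ m =>
    have hr' : IsRadius (Function.update r j s) := by
      refine isRadius_mono hr (fun i => ?_) (fun i => ?_) <;>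
      · by_cases hij : i = j
        · subst hij; simpa
        · simp [hij, hr.1 i]
    have hrest : (fun i => Function.update r j s (j.succAbove i)) = fun i => r (j.succAbove i) := by
      funext i
      simp
    rw [normCoeff, normCoeff, torusCoeff_succ hf p j hr, torusCoeff_succ hf p j hr', hrest,
      Fin.prod_univ_succAbove _ j, Fin.prod_univ_succAbove _ j]
    simp only [Function.update_self, ne_eq, Fin.succAbove_ne, not_false_eq_true,
      Function.update_of_ne]
    simp only [← mul_assoc]
    refine congrArg (· * _) ?_
    rw [← integral_mul_const, ← integral_mul_const]
    refine integral_congr_ae (.of_forall fun t => ?_)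
    have := integral_arc_zpow_invariant hs hsr (p j)
      fun z hz => differentiableAt_insertNth hf j hr t hz
    simp only
    rw [mul_right_comm, this, mul_right_comm]

theorem torusCoeff_eq_zero (hf : DifferentiableOn ℂ f (ball n)) {p : Fin n → ℤ}
    {r : Fin n → ℝ} (hr : IsRadius r) (hp : ∃ j, p j < 0) : torusCoeff f p r = 0 := by
  obtain ⟨j, hj⟩ := hp
  cases n with
  | zero => exact j.elim0
  | succ m =>
    rw [torusCoeff_succ hf p j hr]
    refine integral_eq_zero_of_ae (.of_forall fun t => ?_)
    have := integral_arc_zpow_eq_zero (hr.1 j) hj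
      fun z hz => differentiableAt_insertNth hf j hr t hz
    simp only
    rw [this, zero_mul]
    rfl

theorem normCoeff_of_le (hf : DifferentiableOn ℂ f (ball n)) (p : Fin n → ℤ)
    {r s : Fin n → ℝ} (hr : IsRadius r) (hs : ∀ i, 0 < s i) (hsr : ∀ i, s i ≤ r i) :
    normCoeff f p s = normCoeff f p r := by
  have key : ∀ S : Finset (Fin n), normCoeff f p (S.piecewise s r) = normCoeff f p r := by
    intro S
    induction S using Finset.induction_on with
    | empty => simp
    | insert j S hj ih =>
      rw [Finset.piecewise_insert, normCoeff_update hf p ?_ j (hs j) ?_, ih]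
      · refine isRadius_mono hr (fun i => ?_) fun i => ?_
        · by_cases h : i ∈ S <;> simp [h, hs i, hr.1 i]
        · by_cases h : i ∈ S <;> simp [h, hsr i]
      · simp [hj, hsr j]
  simpa using key Finset.univ

/-- The Fourier coefficients of a holomorphic function on the tori in the ball are monomials in
the radii. -/
theorem exists_torusCoeff_eq (hf : DifferentiableOn ℂ f (ball n)) (p : Fin n → ℤ) :
    ∃ a : ℂ, ∀ r, IsRadius r → torusCoeff f p r = a * ∏ i, (r i : ℂ) ^ p i := by
  by_cases h : ∃ r₀ : Fin n → ℝ, IsRadius r₀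
  · obtain ⟨r₀, hr₀⟩ := h
    refine ⟨normCoeff f p r₀, fun r hr => ?_⟩
    have hmin : ∀ i, 0 < min (r i) (r₀ i) := fun i => lt_min (hr.1 i) (hr₀.1 i)
    rw [← normCoeff_of_le hf p hr₀ hmin fun i => min_le_right _ _,
      normCoeff_of_le hf p hr hmin fun i => min_le_left _ _, normCoeff, mul_assoc,
      ← Finset.prod_mul_distrib]
    have : ∀ i, (r i : ℂ) ^ (-p i) * (r i : ℂ) ^ p i = 1 := fun i => by
      rw [← zpow_add₀ (by exact_mod_cast (hr.1 i).ne'), neg_add_cancel, zpow_zero]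
    simp only [this, Finset.prod_const_one, mul_one]
  · exact ⟨0, fun r hr => (h ⟨r, hr⟩).elim⟩

end

section

variable {n : ℕ} {lam : ℝ}

/-- The radii of the torus `{κ(t, h)}`. -/
def radius {n : ℕ} (h : Fin n → ℝ) : Fin n → ℝ := fun i => √(h i) / √(1 + norm1 h)

theorem kappa_eq_torusPoint (t : Fin n → Circle) (h : Fin n → ℝ) :
    kappa (t, h) = torusPoint (radius h) t := rfl

theorem isRadius_radius {h : Fin n → ℝ} (hh : h ∈ orthant n) : IsRadius (radius h) := by
  refine ⟨fun i => div_pos (Real.sqrt_pos.2 (hh i)) (Real.sqrt_pos.2 (one_add_norm1_pos h)), ?_⟩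
  have h1 : ∀ i, radius h i ^ 2 = h i / (1 + norm1 h) := fun i => by
    rw [radius, div_pow, Real.sq_sqrt (hh i).le, Real.sq_sqrt (one_add_norm1_pos h).le]
  simp_rw [h1]
  rw [← Finset.sum_div, div_lt_one (one_add_norm1_pos h), norm1_of_mem hh]
  linarith

theorem prod_radius_pow {h : Fin n → ℝ} (hh : h ∈ orthant n) (p : Fin n → ℕ) :
    ∏ i, radius h i ^ p i = halfPow h p / (1 + norm1 h) ^ ((deg p : ℝ) / 2) := by
  have h0 := one_add_norm1_pos h
  simp only [radius, div_pow, Finset.prod_div_distrib, halfPow]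
  congr 1
  · refine Finset.prod_congr rfl fun i _ => ?_
    rw [Real.sqrt_eq_rpow, ← Real.rpow_natCast, ← Real.rpow_mul (hh i).le]
    congr 1
    ring
  · rw [Finset.prod_pow_eq_pow_sum, Real.sqrt_eq_rpow, ← Real.rpow_natCast, ← Real.rpow_mul h0.le]
    congr 1
    rw [deg]
    ring

/-- The constant factor of `weightFun`. -/
def weightConst (lam : ℝ) (p : Fin n → ℕ) : ℝ :=
  √((2 * Real.pi) ^ n * poch (lam + 1) (n + deg p) / (multiFact p * poch (lam + 1) n))

theorem weightConst_pos (hlam : -1 < lam) (p : Fin n → ℕ) : 0 < weightConst lam p := by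
  have hb : 0 < lam + 1 := by linarith
  have hp1 := poch_pos hb (n + deg p)
  have hp2 := poch_pos hb n
  have hm := multiFact_pos p
  have hpi := Real.pi_pos
  unfold weightConst
  positivity

theorem weightFun_eq {h : Fin n → ℝ} (hh : h ∈ orthant n) (p : Fin n → ℕ) :
    weightFun lam p h = weightConst lam p * ∏ i, radius h i ^ p i := by
  rw [prod_radius_pow hh]
  rfl

theorem ae_ae_slice (hlam : -1 < lam) {P : (Fin n → Circle) × (Fin n → ℝ) → Prop}
    (hP : ∀ᵐ x ∂(nuMeasure n lam), P x) :
    ∀ᵐ h ∂(orthantMeasure n lam), ∀ᵐ t ∂(torusMeasure n), P (t, h) := by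
  have := isFiniteMeasure_orthantMeasure n hlam
  have h1 : ∀ᵐ x ∂((orthantMeasure n lam).prod (torusMeasure n)), P x.swap := by
    refine (Measure.measurePreserving_swap (μ := orthantMeasure n lam)
      (ν := torusMeasure n)).quasiMeasurePreserving.ae ?_
    exact hP
  exact Measure.ae_ae_of_ae_prod h1

/-- The components of the transform of a function on the ball are its coefficients on tori. -/
theorem fourierEquiv_comp_kappa (hlam : -1 < lam) {g : (Fin n → ℂ) → ℂ}
    (hg : MemLp (g ∘ kappa) 2 (nuMeasure n lam)) (q : Fin n → ℤ) :
    (fourierEquiv hlam (hg.toLp (g ∘ kappa)) q : (Fin n → ℝ) → ℂ) =ᵐ[orthantMeasure n lam]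
      fun h => (fourierConst n : ℂ) * torusCoeff g q (radius h) := by
  have h1 : (fourierEquiv hlam (hg.toLp (g ∘ kappa)) q : (Fin n → ℝ) → ℂ)
      =ᵐ[orthantMeasure n lam] fourierSlice (hg.toLp (g ∘ kappa)) q :=
    isU1_fourierEquiv hlam _ q
  filter_upwards [h1, ae_ae_slice hlam hg.coeFn_toLp] with h hh hs
  rw [hh, fourierSlice, torusCoeff]
  congr 1
  refine integral_congr_ae ?_
  filter_upwards [hs] with t ht
  rw [ht, Function.comp_apply, kappa_eq_torusPoint]

theorem exists_fourierEquiv_eq_smul (hlam : -1 < lam) {g : (Fin n → ℂ) → ℂ}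
    (hd : DifferentiableOn ℂ g (ball n)) (hg : MemLp (g ∘ kappa) 2 (nuMeasure n lam))
    (p : Fin n → ℕ) :
    ∃ a : ℂ, fourierEquiv hlam (hg.toLp (g ∘ kappa)) (natIncl p) = a • weightVec hlam p := by
  obtain ⟨a, ha⟩ := exists_torusCoeff_eq hd (natIncl p)
  have hw : (weightConst lam p : ℂ) ≠ 0 := by exact_mod_cast (weightConst_pos hlam p).ne'
  refine ⟨(fourierConst n : ℂ) * a / weightConst lam p, Lp.ext ?_⟩
  filter_upwards [fourierEquiv_comp_kappa hlam hg (natIncl p),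
    Lp.coeFn_smul ((fourierConst n : ℂ) * a / weightConst lam p) (weightVec hlam p),
    coeFn_weightVec hlam p, ae_mem_orthant n lam] with h h1 h2 h3 hh
  rw [h1, h2, Pi.smul_apply, h3, ha _ (isRadius_radius hh), weightFun_eq hh, smul_eq_mul]
  simp only [natIncl, zpow_natCast]
  push_cast
  field_simp

theorem fourierEquiv_eq_zero (hlam : -1 < lam) {g : (Fin n → ℂ) → ℂ}
    (hd : DifferentiableOn ℂ g (ball n)) (hg : MemLp (g ∘ kappa) 2 (nuMeasure n lam))
    {q : Fin n → ℤ} (hq : ∃ i, q i < 0) :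
    fourierEquiv hlam (hg.toLp (g ∘ kappa)) q = 0 := by
  refine Lp.ext ?_
  filter_upwards [fourierEquiv_comp_kappa hlam hg q, ae_mem_orthant n lam,
    Lp.coeFn_zero ℂ 2 (orthantMeasure n lam)] with h h1 hh h2
  rw [h1, h2, torusCoeff_eq_zero hd (isRadius_radius hh) hq, mul_zero]
  rfl

theorem exists_natIncl_or_neg (q : Fin n → ℤ) : (∃ p, q = natIncl p) ∨ ∃ i, q i < 0 := by
  by_cases h : ∃ i, q i < 0
  · exact .inr h
  · push Not at h
    exact .inl ⟨fun i => (q i).toNat, funext fun i => (Int.toNat_of_nonneg (h i)).symm⟩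

theorem mem_range_weightIsometry (hlam : -1 < lam) (φ : SeqL2Orthant n lam)
    (h1 : ∀ p, ∃ a : ℂ, φ (natIncl p) = a • weightVec hlam p)
    (h2 : ∀ q, (∃ i, q i < 0) → φ q = 0) : φ ∈ Set.range (weightIsometry (n := n) hlam) := by
  refine ⟨ContinuousLinearMap.adjoint (weightIsometry hlam).toContinuousLinearMap φ, ?_⟩
  refine lp.ext (funext fun q => ?_)
  rcases exists_natIncl_or_neg q with ⟨p, rfl⟩ | hq
  · refine (weightIsometry_apply_natIncl hlam _ p).trans ?_
    obtain ⟨a, ha⟩ := h1 p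
    rw [adjoint_weightIsometry_apply, ha, inner_smul_right, inner_self_eq_norm_sq_to_K,
      norm_weightVec]
    simp
  · exact (weightIsometry_apply_of_neg hlam _ hq).trans (h2 q hq).symm

theorem map_bergman_subset (hlam : -1 < lam) {U₀ : L2Ball n lam ≃ₗᵢ[ℂ] L2Coord n lam}
    (hU₀ : IsU0 U₀) {f : L2Ball n lam} (hf : f ∈ bergman n lam) :
    fourierEquiv hlam (U₀ f) ∈ Set.range (weightIsometry (n := n) hlam) := by
  obtain ⟨g, hd, hfg⟩ := hf
  have hg : MemLp g 2 (vMeasure n lam) := (memLp_congr_ae hfg).1 (Lp.memLp f)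
  have hfeq : f = hg.toLp g := Lp.ext (hfg.trans hg.coeFn_toLp.symm)
  obtain ⟨hgk, hU⟩ := hU₀ g hg
  rw [hfeq, hU]
  exact mem_range_weightIsometry hlam _ (exists_fourierEquiv_eq_smul hlam hd hgk)
    fun q hq => fourierEquiv_eq_zero hlam hd hgk hq

end

/-- A series converging both in `L²` and almost everywhere has one sum. -/
theorem hasSum_Lp_ae_eq {α ι : Type*} [MeasurableSpace α] [Countable ι] {μ : Measure α}
    {f : ι → Lp ℂ 2 μ} {F : Lp ℂ 2 μ} (hF : HasSum f F) {g : ι → α → ℂ} {G : α → ℂ}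
    (hfg : ∀ i, f i =ᵐ[μ] g i) (hG : ∀ᵐ x ∂μ, HasSum (fun i => g i x) (G x)) : F =ᵐ[μ] G := by
  have h1 : TendstoInMeasure μ (fun s : Finset ι => (∑ i ∈ s, f i : Lp ℂ 2 μ)) Filter.atTop F :=
    tendstoInMeasure_of_tendsto_Lp hF
  obtain ⟨ns, hns, hlim⟩ := h1.exists_seq_tendsto_ae'
  have h2 : ∀ᵐ x ∂μ, ∀ s : Finset ι, (∑ i ∈ s, f i : Lp ℂ 2 μ) x = ∑ i ∈ s, g i x := by
    rw [ae_all_iff]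
    intro s
    filter_upwards [Lp.coeFn_finsetSum s f, ae_all_iff.2 hfg] with x hx hi
    rw [hx, Finset.sum_apply]
    exact Finset.sum_congr rfl fun i _ => hi i
  filter_upwards [hlim, h2, hG] with x hx h2x hGx
  refine tendsto_nhds_unique hx ?_
  simp_rw [h2x]
  exact hGx.comp hns

variable {n : ℕ} {lam : ℝ}

/-- The coefficient of the normalized monomial of exponent `p`. -/
def monomialConst (lam : ℝ) (p : Fin n → ℕ) : ℝ := fourierConst n * weightConst lam p

theorem monomialConst_pos (hlam : -1 < lam) (p : Fin n → ℕ) : 0 < monomialConst lam p :=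
  mul_pos (fourierConst_pos n) (weightConst_pos hlam p)

theorem monomialConst_sq (hlam : -1 < lam) (p : Fin n → ℕ) :
    monomialConst lam p ^ 2 =
      (Real.Gamma (lam + 1 + n))⁻¹ * (Real.Gamma (lam + 1 + n + deg p) / multiFact p) := by
  have hb : 0 < lam + 1 := by linarith
  have hp1 := poch_pos hb (n + deg p)
  have hp2 := poch_pos hb n
  have hm := multiFact_pos p
  have hpi := Real.pi_pos
  have h1 := fourierConst_sq_mul n
  have hG := (Real.Gamma_pos_of_pos hb).ne'
  have hG2 := (Real.Gamma_pos_of_pos (show 0 < lam + 1 + n by positivity)).ne'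
  rw [monomialConst, weightConst, mul_pow, Real.sq_sqrt (by positivity), mul_div_assoc, ← mul_assoc,
    sq (fourierConst n), h1, poch_eq_Gamma hb, poch_eq_Gamma hb, Nat.cast_add, ← add_assoc]
  field_simp

/-- The normalized monomial of exponent `p`. -/
def monomialFun (lam : ℝ) (p : Fin n → ℕ) (z : Fin n → ℂ) : ℂ :=
  (monomialConst lam p : ℂ) * ∏ i, z i ^ p i

theorem differentiable_monomialFun (p : Fin n → ℕ) : Differentiable ℂ (monomialFun lam p) := by
  unfold monomialFun
  fun_prop

theorem norm_monomialFun_le (hlam : -1 < lam) (p : Fin n → ℕ) {z : Fin n → ℂ} {R : Fin n → ℝ}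
    (hR : ∀ i, ‖z i‖ ≤ R i) : ‖monomialFun lam p z‖ ≤ monomialConst lam p * ∏ i, R i ^ p i := by
  rw [monomialFun, norm_mul, Complex.norm_real, Real.norm_of_nonneg (monomialConst_pos hlam p).le,
    norm_prod]
  refine mul_le_mul_of_nonneg_left ?_ (monomialConst_pos hlam p).le
  refine Finset.prod_le_prod (fun i _ => norm_nonneg _) fun i _ => ?_
  rw [norm_pow]
  exact pow_le_pow_left₀ (norm_nonneg _) (hR i) _

theorem summable_norm_mul_monomial (hlam : -1 < lam) (ψ : SeqNat n) {R : Fin n → ℝ}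
    (hR : ∑ i, R i ^ 2 < 1) :
    Summable fun p : Fin n → ℕ => ‖ψ p‖ * (monomialConst lam p * ∏ i, R i ^ p i) := by
  have h1 : Summable fun p => ‖ψ p‖ ^ 2 := by
    simpa using (lp.memℓp ψ).summable (by simp)
  have h2 : Summable fun p : Fin n → ℕ => (monomialConst lam p * ∏ i, R i ^ p i) ^ 2 := by
    have hN : 0 < lam + 1 + n := by have := n.cast_nonneg (α := ℝ); linarith
    refine ((summable_Gamma_mul_pow hN (fun i => sq_nonneg (R i)) hR).mul_left
      (Real.Gamma (lam + 1 + n))⁻¹).congr fun p => ?_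
    rw [mul_pow, monomialConst_sq hlam, ← Finset.prod_pow, mul_assoc]
    simp_rw [← pow_mul, mul_comm]
  refine Summable.of_norm_bounded (h1.add h2) fun p => ?_
  rw [norm_mul, norm_norm]
  have := sq_nonneg (‖ψ p‖ - ‖monomialConst lam p * ∏ i, R i ^ p i‖)
  have h3 : ‖monomialConst lam p * ∏ i, R i ^ p i‖ ^ 2 =
    (monomialConst lam p * ∏ i, R i ^ p i) ^ 2 := by rw [Real.norm_eq_abs, sq_abs]
  nlinarith [sq_nonneg (‖ψ p‖), sq_nonneg (‖monomialConst lam p * ∏ i, R i ^ p i‖)]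

theorem summable_monomialFun (hlam : -1 < lam) (ψ : SeqNat n) {z : Fin n → ℂ} (hz : z ∈ ball n) :
    Summable fun p => ψ p * monomialFun lam p z := by
  refine Summable.of_norm_bounded
    (summable_norm_mul_monomial hlam ψ (R := fun i => ‖z i‖) hz) fun p => ?_
  rw [norm_mul]
  exact mul_le_mul_of_nonneg_left (norm_monomialFun_le hlam p fun i => le_rfl) (norm_nonneg _)

theorem differentiableOn_tsum_monomialFun (hlam : -1 < lam) (ψ : SeqNat n) :
    DifferentiableOn ℂ (fun z => ∑' p, ψ p * monomialFun lam p z) (ball n) := by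
  intro z hz
  have hcont : Filter.Tendsto (fun δ : ℝ => ∑ i, (‖z i‖ + 2 * δ) ^ 2) (nhdsWithin 0 (Set.Ioi 0))
      (nhds (∑ i, ‖z i‖ ^ 2)) := by
    have : Continuous fun δ : ℝ => ∑ i, (‖z i‖ + 2 * δ) ^ 2 := by fun_prop
    simpa using (this.tendsto 0).mono_left nhdsWithin_le_nhds
  obtain ⟨δ, hδ1, hδ⟩ := ((hcont.eventually (gt_mem_nhds hz)).and self_mem_nhdsWithin).exists
  have hδ : 0 < δ := hδ
  have hnorm : ∀ y ∈ Metric.ball z (2 * δ), ∀ i, ‖y i‖ ≤ ‖z i‖ + 2 * δ := by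
    intro y hy i
    have h1 : ‖y i - z i‖ ≤ ‖y - z‖ := norm_le_pi_norm (y - z) i
    have h2 : ‖y - z‖ < 2 * δ := by rwa [← mem_ball_iff_norm]
    have h3 : ‖y i‖ ≤ ‖z i‖ + ‖y i - z i‖ := by
      simpa using norm_add_le (z i) (y i - z i)
    linarith
  set M : (Fin n → ℕ) → ℝ := fun p =>
    ‖ψ p‖ * (monomialConst lam p * ∏ i, (‖z i‖ + 2 * δ) ^ p i) with hM
  have hMsum : Summable M := summable_norm_mul_monomial hlam ψ hδ1
  have hbound : ∀ p, ∀ y ∈ Metric.ball z (2 * δ), ‖ψ p * monomialFun lam p y‖ ≤ M p := by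
    intro p y hy
    rw [norm_mul]
    exact mul_le_mul_of_nonneg_left (norm_monomialFun_le hlam p (hnorm y hy)) (norm_nonneg _)
  have hdiff : ∀ p, Differentiable ℂ fun y => ψ p * monomialFun lam p y := fun p =>
    (differentiable_monomialFun p).const_mul _
  have hderiv : ∀ p, ∀ y ∈ Metric.ball z δ,
      ‖fderiv ℂ (fun y => ψ p * monomialFun lam p y) y‖ ≤ 2 * M p / δ := by
    intro p y hy
    refine Complex.norm_fderiv_le_div_of_mapsTo_ball (hdiff p).differentiableOn ?_ hδ
    intro w hw
    have hsub : ∀ w ∈ Metric.ball y δ, w ∈ Metric.ball z (2 * δ) := fun w hw => by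
      have := dist_triangle w y z
      have h1 := Metric.mem_ball.1 hw
      have h2 := Metric.mem_ball.1 hy
      exact Metric.mem_ball.2 (by linarith)
    rw [mem_closedBall_iff_norm]
    refine (norm_sub_le _ _).trans ?_
    linarith [hbound p w (hsub w hw), hbound p y (hsub y (Metric.mem_ball_self hδ))]
  have := hasFDerivAt_tsum_of_isPreconnected (𝕜 := ℂ) ((hMsum.mul_left 2).div_const δ)
    Metric.isOpen_ball (convex_ball z δ).isPreconnected
    (fun p y _ => (hdiff p y).hasFDerivAt) hderiv (Metric.mem_ball_self hδ)
    (summable_monomialFun hlam ψ hz) (Metric.mem_ball_self hδ)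
  exact this.differentiableAt.differentiableWithinAt

theorem monomialFun_comp_kappa (hlam : -1 < lam) (p : Fin n → ℕ) :
    monomialFun lam p ∘ kappa =ᵐ[nuMeasure n lam] charMul (natIncl p) (weightVec hlam p) := by
  have h1 := charMul_congr hlam (natIncl p) (coeFn_weightVec hlam p)
  refine Filter.EventuallyEq.trans ?_ h1.symm
  filter_upwards [ae_snd_mem_orthant n hlam] with x hx
  rw [Function.comp_apply, charMul, weightFun_eq hx, show x = (x.1, x.2) from rfl,
    kappa_eq_torusPoint, monomialFun, monomialConst]
  simp only [torusPoint, torusChar, natIncl, zpow_natCast, mul_pow, Finset.prod_mul_distrib]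
  push_cast
  ring

theorem memLp_monomialFun (hlam : -1 < lam) (p : Fin n → ℕ) :
    MemLp (monomialFun lam p) 2 (vMeasure n lam) := by
  have hk := measurePreserving_kappa n hlam
  have hm : AEStronglyMeasurable (monomialFun lam p) (vMeasure n lam) :=
    (differentiable_monomialFun p).continuous.aestronglyMeasurable
  rw [← hk.map_eq, memLp_map_measure_iff (by rwa [hk.map_eq]) hk.aemeasurable]
  exact (memLp_congr_ae (monomialFun_comp_kappa hlam p)).2
    (memLp_charMul hlam _ (Lp.memLp _))

theorem fourierEquiv_monomial (hlam : -1 < lam) {U₀ : L2Ball n lam ≃ₗᵢ[ℂ] L2Coord n lam}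
    (hU₀ : IsU0 U₀) (p : Fin n → ℕ) :
    fourierEquiv hlam (U₀ ((memLp_monomialFun hlam p).toLp _)) = weightSeq hlam p := by
  obtain ⟨hk, hU⟩ := hU₀ _ (memLp_monomialFun hlam p)
  have h1 : hk.toLp _ = charEmb hlam (natIncl p) (weightVec hlam p) :=
    Lp.ext (hk.coeFn_toLp.trans ((monomialFun_comp_kappa hlam p).trans
      (coeFn_charEmb hlam _ _).symm))
  rw [hU, h1, ← fourierEquiv_symm_single, LinearIsometryEquiv.apply_symm_apply]
  rfl

theorem ae_mem_ball (n : ℕ) (lam : ℝ) : ∀ᵐ z ∂(vMeasure n lam), z ∈ ball n :=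
  (withDensity_absolutelyContinuous _ _).ae_le
    ((ae_restrict_iff' (measurableSet_ball n)).2 (.of_forall fun _ h => h))

theorem range_weightIsometry_subset (hlam : -1 < lam) {U₀ : L2Ball n lam ≃ₗᵢ[ℂ] L2Coord n lam}
    (hU₀ : IsU0 U₀) (ψ : SeqNat n) :
    ∃ f ∈ bergman n lam, fourierEquiv hlam (U₀ f) = weightIsometry hlam ψ := by
  set U := U₀.trans (fourierEquiv hlam)
  refine ⟨U.symm (weightIsometry hlam ψ), ?_, U.apply_symm_apply _⟩
  have h1 : HasSum (fun p => ψ p • (memLp_monomialFun hlam p).toLp (monomialFun lam p))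
      (U.symm (weightIsometry hlam ψ)) := by
    have h2 := (hasSum_weightIsometry hlam ψ).mapL
      (U.symm.toLinearIsometry.toContinuousLinearMap)
    refine HasSum.congr_fun h2 fun p => ?_
    change _ = U.symm (ψ p • weightSeq hlam p)
    rw [← fourierEquiv_monomial hlam hU₀ p, map_smul]
    exact congrArg _ (U.symm_apply_apply _).symm
  refine ⟨fun z => ∑' p, ψ p * monomialFun lam p z, differentiableOn_tsum_monomialFun hlam ψ, ?_⟩
  refine hasSum_Lp_ae_eq h1 (g := fun p z => ψ p * monomialFun lam p z) (fun p => ?_) ?_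
  · filter_upwards [Lp.coeFn_smul (ψ p) ((memLp_monomialFun hlam p).toLp (monomialFun lam p)),
      (memLp_monomialFun hlam p).coeFn_toLp] with z h2 h3
    rw [h2, Pi.smul_apply, h3, smul_eq_mul]
  · filter_upwards [ae_mem_ball n lam] with z hz
    exact (summable_monomialFun hlam ψ hz).hasSum

end QuasiElliptic

end

open QuasiElliptic in
theorem mainTheorem3 (n : ℕ) (hn : 1 ≤ n) (lam : ℝ) (hlam : -1 < lam) :
    ∃ (U₀ : L2Ball n lam ≃ₗᵢ[ℂ] L2Coord n lam)
      (U₁ : L2Coord n lam ≃ₗᵢ[ℂ] SeqL2Orthant n lam)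
      (W : SeqNat n →ₗᵢ[ℂ] SeqL2Orthant n lam),
      IsU0 U₀ ∧ IsU1 U₁ ∧ IsW W ∧
      Set.range W = (fun f => U₁ (U₀ f)) '' (bergman n lam : Set (L2Ball n lam)) ∧
      (∀ (φ : SeqL2Orthant n lam) (p : Fin n → ℕ),
        IntegrableOn (adjointIntegrand φ p) (orthant n) ∧
        ContinuousLinearMap.adjoint W.toContinuousLinearMap φ p =
          ((√(poch (lam + 1) n * poch (lam + 1) (n + deg p) /
              ((2 * Real.pi) ^ n * multiFact p)) : ℝ) : ℂ) *
            ∫ h in orthant n, adjointIntegrand φ p h) ∧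
      Function.Surjective (ROp U₀ U₁ W) ∧
      IsPartialIsometryWithInitialSpace (ROp U₀ U₁ W) (bergman n lam) := by
  obtain ⟨U₀, hU₀⟩ := exists_isU0 n hlam
  have hinv : ∀ ψ, ContinuousLinearMap.adjoint
      (weightIsometry (n := n) hlam).toContinuousLinearMap (weightIsometry hlam ψ) = ψ := by
    intro ψ
    refine ext_inner_left ℂ fun v => ?_
    rw [ContinuousLinearMap.adjoint_inner_right]
    exact (weightIsometry hlam).inner_map_map v ψ
  have hR : ∀ f, ROp U₀ (fourierEquiv hlam) (weightIsometry hlam) f =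
      ContinuousLinearMap.adjoint (weightIsometry (n := n) hlam).toContinuousLinearMap
        (fourierEquiv hlam (U₀ f)) := fun f => rfl
  have hmem : ∀ f, f ∈ bergman n lam ↔
      ∃ ψ, weightIsometry hlam ψ = fourierEquiv hlam (U₀ f) := by
    refine fun f => ⟨fun hf => map_bergman_subset hlam hU₀ hf, ?_⟩
    rintro ⟨ψ, hψ⟩
    obtain ⟨g, hg, hgψ⟩ := range_weightIsometry_subset hlam hU₀ ψ
    rwa [← U₀.injective ((fourierEquiv hlam).injective (hgψ.trans hψ))]
  have hle : bergman n lam ≤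
      (LinearMap.ker (ROp U₀ (fourierEquiv hlam) (weightIsometry hlam)).toLinearMap)ᗮ := by
    intro f hf
    obtain ⟨ψ, hψ⟩ := (hmem f).1 hf
    rw [Submodule.mem_orthogonal]
    intro g hg
    have hg0 : ContinuousLinearMap.adjoint (weightIsometry (n := n) hlam).toContinuousLinearMap
      (fourierEquiv hlam (U₀ g)) = 0 := hg
    rw [← U₀.inner_map_map, ← (fourierEquiv hlam).inner_map_map, ← hψ]
    have := ContinuousLinearMap.adjoint_inner_left
      (weightIsometry (n := n) hlam).toContinuousLinearMap ψ (fourierEquiv hlam (U₀ g))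
    rw [hg0, inner_zero_left] at this
    exact this.symm
  refine ⟨U₀, fourierEquiv hlam, weightIsometry hlam, hU₀, isU1_fourierEquiv hlam,
    isW_weightIsometry hlam, ?_, adjoint_formula hlam, ?_, ?_, ?_⟩
  · refine Set.Subset.antisymm ?_ ?_
    · rintro _ ⟨ψ, rfl⟩
      obtain ⟨f, hf, hfψ⟩ := range_weightIsometry_subset hlam hU₀ ψ
      exact ⟨f, hf, hfψ⟩
    · rintro _ ⟨f, hf, rfl⟩
      exact map_bergman_subset hlam hU₀ hf
  · intro ψ
    obtain ⟨f, _, hfψ⟩ := range_weightIsometry_subset hlam hU₀ ψ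
    exact ⟨f, by rw [hR, hfψ, hinv]⟩
  · refine le_antisymm hle fun f hf => ?_
    obtain ⟨k, hk, hkψ⟩ := range_weightIsometry_subset hlam hU₀
      (ROp U₀ (fourierEquiv hlam) (weightIsometry hlam) f)
    have hker : f - k ∈ LinearMap.ker
        (ROp U₀ (fourierEquiv hlam) (weightIsometry hlam)).toLinearMap := by
      rw [LinearMap.mem_ker, map_sub, sub_eq_zero]
      change ROp U₀ (fourierEquiv hlam) (weightIsometry hlam) f =
        ROp U₀ (fourierEquiv hlam) (weightIsometry hlam) k
      rw [hR k, hkψ, hinv]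
    have horth := hle hk
    have h0 := Submodule.inner_right_of_mem_orthogonal hker (Submodule.sub_mem _ hf horth)
    rwa [sub_eq_zero.1 (inner_self_eq_zero.1 h0)]
  · intro f hf
    obtain ⟨ψ, hψ⟩ := (hmem f).1 hf
    rw [hR, ← hψ, hinv, ← (weightIsometry hlam).norm_map ψ, hψ, LinearIsometryEquiv.norm_map,
      LinearIsometryEquiv.norm_map]
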